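/- Let $\kappa$ be a regular uncountable cardinal with $2^{<\kappa}=\kappa$, let $\tau<\kappa$ be an infinite regular cardinal, and let $\bar\mu=\langle\mu_\alpha:\alpha<\tau\rangle$ be a non-decreasing sequence of regular cardinals with $\kappa\le\mu_0$ and $|\prod_{\alpha<\tau}\mu_\alpha|=2^\kappa$. Let $\pi:\prod_{\alpha<\tau}\mu_\alpha\to{}^{\kappa}\kappa$, $\eta\mapsto\pi_\eta$, be a bijection. For $u\subseteq\prod_{\alpha<\tau}\mu_\alpha$ put $T(u)=\{\eta{\restriction}\alpha:\alpha<\tau,\ \eta\in u\}$. Let $\mathbb Q=\mathbb Q(\pi,\bar\mu,\kappa)$ be the set of all $p=(i,u,\bar f,g)$ such that $i<\kappa$; $u\subseteq\prod_{\alpha<\tau}\mu_\alpha$ and $|u|<\kappa$; $\bar f=\langle f_\sigma:\sigma\in T(u)\rangle$ with $f_\sigma:i\to\kappa$; $g:u\to i+1$; and $\pi_\eta(j)<\sup\{f_{\eta\restriction\alpha}(j):\alpha<\tau\}$ whenever $\eta\in u$ and $g(\eta)\le j<i$. It is ordered by: $p\le q$ ($q$ is stronger) iff $i^p\le i^q$,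 $u^p\subseteq u^q$, $g^p\subseteq g^q$, and $f^p_\sigma\subseteq f^q_\sigma$ for all $\sigma\in T(u^p)$. For a forcing notion $\mathbb P$ (a preorder with a weakest element $\emptyset_{\mathbb P}$ that is equivalent to no other condition) define: * $\mathbb P$ is $\lambda$-complete ($\lambda$-lub-complete) if every increasing chain of length $<\lambda$ has an upper bound (a least upper bound). * For a limit ordinal $\varepsilon<\kappa$, $\mathbb P$ satisfies $(*)^\varepsilon_\kappa$ if Player I has a winning strategy in the following game of length $\varepsilon$. At stage $\alpha$ Player I picks conditions $q^\alpha_i$ ($i<\kappa^+$) and $\varphi^\alpha:\kappa^+\to\kappa^+$, where $q^0_i=\emptyset_{\mathbb P}$ and $\varphi^0=0$, and, for $\alpha>0$, $p^\beta_i\le q^\alpha_i$ for all $\beta<\alpha$ and $i<\kappa^+$, and $\varphi^\alpha(i)<1+i$. Player II answers with conditions $p^\alpha_i\ge q^\alpha_i$. Player I loses if he has no legal move. He wins a play of length $\varepsilon$ if there is a club $C\subseteq\kappa^+$ such that for all distinct $i,j\in C$ with $\mathrm{cf}(i)=\mathrm{cf}(j)=\kappa$ and $\varphi^\alpha(i)=\varphi^\alpha(j)$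 for all $\alpha<\varepsilon$, the set $\{p^\alpha_i,p^\alpha_j:\alpha<\varepsilon\}$ has an upper bound. * For a regular cardinal $\chi$ let $\mathcal H(\chi)$ be the set of all sets hereditarily of size $<\chi$ and $<^*_\chi$ a well-ordering of it. A model $N\prec(\mathcal H(\chi),\in,<^*_\chi)$ is $(\mathbb P,\kappa,\iota)$-relevant if $\mathbb P,\iota\in N$, $\iota\subseteq N$, $|N|=\iota$ and ${}^{<\kappa}N\subseteq N$. For such $N$ and a cardinal $\theta<\kappa$, in the game $\Game^m(N,\theta,\mathbb P)$ of length $\theta$ conditions $q_i\in N\cap\mathbb P$ and $p_i\in\mathbb P$ are chosen with $q_i\le p_i$ and $q_j\le q_i$, $p_j\le p_i$ for all $j<i$, by Him if $i$ is even (limit ordinals included) and by Her if $i$ is odd. She wins if, for all least upper bounds $p_\theta$ of $\langle p_i:i<\theta\rangle$ and $q_\theta$ of $\langle q_i:i<\theta\rangle$, every $q\in N\cap\mathbb P$ with $q_\theta\le q$ is compatible with $p_\theta$. * $\mathbb P$ is $(\theta,\iota,\kappa)$-manageable if it is $\kappa$-complete and $\theta^+$-lub-complete, satisfies $(*)^\theta_\kappa$,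 and for every sufficiently large regular $\chi$ and every well-ordering $<^*_\chi$ of $\mathcal H(\chi)$ there is $x\in\mathcal H(\chi)$ such that She has a winning strategy in $\Game^m(N,\theta,\mathbb P)$ for every $(\mathbb P,\kappa,\iota)$-relevant $N\prec(\mathcal H(\chi),\in,<^*_\chi)$ with $x\in N$. **Theorem.** Let $\theta$ and $\iota$ be cardinals with $\theta$ infinite and regular, $\theta<\kappa$ and $\theta<\iota=\iota^{<\kappa}$. Then $\mathbb Q$ is a forcing notion, it is $\kappa$-lub-complete, and it is $(\theta,\iota,\kappa)$-manageable. Moreover, let $\dot f_\sigma$ (for $\sigma\in\bigcup_{\alpha<\tau}\prod_{\beta<\alpha}\mu_\beta$) be the $\mathbb Q$-name for the union of all $f^p_\sigma$ with $p$ in the generic filter and $\sigma\in T(u^p)$. Then $\mathbb Q$ forces that every $\dot f_\sigma$ is a function from $\kappa$ to $\kappa$, and that for every ground-model $h:\kappa\to\kappa$ there is a ground-model set $S\subseteq\bigcup_{\alpha<\tau}\prod_{\beta<\alpha}\mu_\beta$ with $|S|\le\tau$ such that $h(j)<\sup\{\dot f_\sigma(j):\sigma\in S\}$ for all $j<\kappa$.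 -/

import Mathlib

universe u

open Cardinal

noncomputable section

namespace Manageability

/-! ### Forcing notions

All set-theoretic objects are elements of `ZFSet.{u}`. Ordinals and cardinals are Lean's
`Ordinal.{u}` and `Cardinal.{u}`; inside `ZFSet` the ordinal `o` is the von Neumann ordinal
`o.toZFSet` and the cardinal `c` is its initial ordinal. A stronger condition is a larger one. -/

/-- The cardinal `c` as a set: the initial von Neumann ordinal of size `c`. -/
def cardSet (c : Cardinal.{u}) : ZFSet.{u} := c.ord.toZFSet

/-- A set together with a binary relation on it, both of them sets. -/
structure RelSet where
  carrier : ZFSet.{u}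
  rel : ZFSet.{u}

namespace RelSet

/-- The pair `(P, ≤)` as a single set. -/
def toZFSet (P : RelSet.{u}) : ZFSet.{u} := ZFSet.pair P.carrier P.rel

/-- `p ≤ q`: the condition `q` is stronger than `p`. -/
def le (P : RelSet.{u}) (p q : ZFSet.{u}) : Prop := ZFSet.pair p q ∈ P.rel

/-- `e` is a weakest condition. -/
def IsWeakest (P : RelSet.{u}) (e : ZFSet.{u}) : Prop :=
  e ∈ P.carrier ∧ ∀ p ∈ P.carrier, P.le e p

/-- A forcing notion: a preordered set with a weakest condition which is equivalent to no other
condition, that is, with exactly one weakest condition. -/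
structure IsForcingNotion (P : RelSet.{u}) : Prop where
  mem_of_le : ∀ z ∈ P.rel, ∃ p ∈ P.carrier, ∃ q ∈ P.carrier, z = ZFSet.pair p q
  refl : ∀ p ∈ P.carrier, P.le p p
  trans : ∀ p q r, P.le p q → P.le q r → P.le p r
  weakest : ∃! e, P.IsWeakest e

/-- `b` is an upper bound of `S` in `P`. -/
def IsUpperBound (P : RelSet.{u}) (S : Set ZFSet.{u}) (b : ZFSet.{u}) : Prop :=
  b ∈ P.carrier ∧ ∀ a ∈ S, P.le a b

/-- `b` is a least upper bound of `S` in `P`. -/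
def IsLeastUpperBound (P : RelSet.{u}) (S : Set ZFSet.{u}) (b : ZFSet.{u}) : Prop :=
  P.IsUpperBound S b ∧ ∀ c, P.IsUpperBound S c → P.le b c

/-- `p` and `q` are compatible. -/
def Compatible (P : RelSet.{u}) (p q : ZFSet.{u}) : Prop :=
  ∃ r ∈ P.carrier, P.le p r ∧ P.le q r

/-- `⟨s ξ : ξ < δ⟩` is a `≤`-increasing chain of conditions. -/
def IsChainOn (P : RelSet.{u}) (δ : Ordinal.{u}) (s : Ordinal.{u} → ZFSet.{u}) : Prop :=
  (∀ ξ < δ, s ξ ∈ P.carrier) ∧ ∀ ξ ζ, ξ ≤ ζ → ζ < δ → P.le (s ξ) (s ζ)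

/-- `θ`-completeness: increasing chains of length less than `θ` have upper bounds. -/
def Complete (P : RelSet.{u}) (θ : Cardinal.{u}) : Prop :=
  ∀ δ < θ.ord, ∀ s, P.IsChainOn δ s → ∃ b, P.IsUpperBound (s '' Set.Iio δ) b

/-- `θ`-lub-completeness: increasing chains of length less than `θ` have least upper bounds. -/
def LubComplete (P : RelSet.{u}) (θ : Cardinal.{u}) : Prop :=
  ∀ δ < θ.ord, ∀ s, P.IsChainOn δ s → ∃ b, P.IsLeastUpperBound (s '' Set.Iio δ) b

end RelSet

/-! ### The chain condition game -/

/-- The ordinals below `κ⁺`. -/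
abbrev Idx (κ : Cardinal.{u}) : Type (u + 1) := Set.Iio (Order.succ κ).ord

/-- One round of the chain condition game: Player I chooses the sequence `q` and the function `φ`
on `κ⁺`, Player II answers with the sequence `p`. -/
structure CCRound (κ : Cardinal.{u}) where
  q : Idx κ → ZFSet.{u}
  φ : Idx κ → Ordinal.{u}
  p : Idx κ → ZFSet.{u}

/-- Player I's move at stage `α` is legal. -/
def CCLegalI (P : RelSet.{u}) (κ : Cardinal.{u}) (play : Ordinal.{u} → CCRound κ)
    (α : Ordinal.{u}) : Prop :=
  (∀ i, (play α).q i ∈ P.carrier) ∧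
  (α = 0 → ∀ i, P.IsWeakest ((play α).q i) ∧ (play α).φ i = 0) ∧
  (0 < α → (∀ β < α, ∀ i, P.le ((play β).p i) ((play α).q i)) ∧
    ∀ i : Idx κ, (play α).φ i < 1 + (i : Ordinal.{u}))

/-- Player II's move at stage `α` is legal. -/
def CCLegalII (P : RelSet.{u}) (κ : Cardinal.{u}) (play : Ordinal.{u} → CCRound κ)
    (α : Ordinal.{u}) : Prop :=
  ∀ i, (play α).p i ∈ P.carrier ∧ P.le ((play α).q i) ((play α).p i)

/-- The winning condition of Player I for a play of length `ε`. -/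
def CCWinI (P : RelSet.{u}) (κ : Cardinal.{u}) (ε : Ordinal.{u})
    (play : Ordinal.{u} → CCRound κ) : Prop :=
  ∃ C : Set (Idx κ), IsClub C ∧ ∀ i ∈ C, ∀ j ∈ C, i ≠ j →
    (i : Ordinal.{u}).cof = κ → (j : Ordinal.{u}).cof = κ →
    (∀ α < ε, (play α).φ i = (play α).φ j) →
    ∃ b, P.IsUpperBound
      {x | ∃ α < ε, x = (play α).p i ∨ x = (play α).p j} b

/-- A strategy of Player I: his next move as a function of the rounds played so far. -/
abbrev CCStrategy (κ : Cardinal.{u}) : Type (u + 1) :=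
  (α : Ordinal.{u}) → (Set.Iio α → CCRound κ) → (Idx κ → ZFSet.{u}) × (Idx κ → Ordinal.{u})

/-- Player I's move at stage `α` is the one told by the strategy `st`. -/
def CCFollows (κ : Cardinal.{u}) (st : CCStrategy κ) (play : Ordinal.{u} → CCRound κ)
    (α : Ordinal.{u}) : Prop :=
  ((play α).q, (play α).φ) = st α (fun β => play β)

/-- The condition `(*)^ε_κ`: Player I has a winning strategy in the chain condition game of length
`ε`. As long as he follows it and Player II moves legally, his moves are legal (so that he never
gets stuck), and he wins every play that lasts `ε` steps. -/
def StarCondition (P : RelSet.{u}) (κ : Cardinal.{u}) (ε : Ordinal.{u}) : Prop :=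
  ∃ st : CCStrategy κ, ∀ play : Ordinal.{u} → CCRound κ,
    (∀ δ < ε, (∀ α ≤ δ, CCFollows κ st play α) → (∀ α < δ, CCLegalII P κ play α) →
      CCLegalI P κ play δ) ∧
    ((∀ α < ε, CCFollows κ st play α) → (∀ α < ε, CCLegalII P κ play α) →
      CCWinI P κ ε play)

/-! ### Elementary submodels of `(H(χ), ∈, <*)` -/

/-- `x ∈ H(χ)`: `x` is hereditarily of size less than `χ`, i.e. `x` is included in a transitive
set of size less than `χ` (equivalently, its transitive closure has size less than `χ`). -/
def InH (χ : Cardinal.{u}) (x : ZFSet.{u}) : Prop :=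
  ∃ t : ZFSet.{u}, t.IsTransitive ∧ x ⊆ t ∧ t.card < χ

/-- The universe of `H(χ)`. -/
abbrev HSet (χ : Cardinal.{u}) : Type (u + 1) := {x : ZFSet.{u} // InH χ x}

/-- Two binary relation symbols: membership and the well-ordering. -/
inductive SetRel : ℕ → Type
  | mem : SetRel 2
  | lt : SetRel 2

/-- The language with these two binary relation symbols and nothing else. -/
def setLang : FirstOrder.Language := ⟨fun _ => Empty, SetRel⟩

/-- The universe `H(χ)`, tagged with the well-ordering that it carries as a structure. -/
def HModel (χ : Cardinal.{u}) (_lt : HSet χ → HSet χ → Prop) : Type (u + 1) := HSet χ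

/-- The structure `(H(χ), ∈, <*)`. -/
instance HModel.structure (χ : Cardinal.{u}) (lt : HSet χ → HSet χ → Prop) :
    setLang.Structure (HModel χ lt) where
  funMap f := nomatch f
  RelMap r := match r with
    | .mem => fun v => (show HSet χ from v 0).1 ∈ (show HSet χ from v 1).1
    | .lt => fun v => lt (v 0) (v 1)

/-- An elementary submodel `N` of `(H(χ), ∈, <*)`. -/
abbrev Submodel (χ : Cardinal.{u}) (lt : HSet χ → HSet χ → Prop) : Type (u + 1) :=
  setLang.ElementarySubstructure (HModel χ lt)

/-- The set of those sets that belong to the submodel `N`. -/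
def Submodel.sets {χ : Cardinal.{u}} {lt : HSet χ → HSet χ → Prop} (N : Submodel χ lt) :
    Set ZFSet.{u} :=
  {x | ∃ h : InH χ x, (show HModel χ lt from (⟨x, h⟩ : HSet χ)) ∈ N}

/-- `N` is `(P, κ, μ)`-relevant: `P, μ ∈ N`, `μ ⊆ N`, `|N| = μ`, and every sequence of length less
than `κ` of elements of `N` belongs to `N`. -/
structure IsRelevant (P : RelSet.{u}) (κ μ : Cardinal.{u}) (N : Set ZFSet.{u}) : Prop where
  forcing_mem : P.toZFSet ∈ N
  card_mem : cardSet μ ∈ N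
  card_subset : ∀ x ∈ cardSet μ, x ∈ N
  card_eq : #N = Cardinal.lift.{u + 1} μ
  closed : ∀ δ < κ.ord, ∀ y : ZFSet.{u}, (∀ v ∈ y, v ∈ N) →
    ∀ s ∈ ZFSet.funs δ.toZFSet y, s ∈ N

/-! ### The manageability game -/

/-- The `i`-th move `(q i, p i)` is legal, whoever makes it. -/
structure MLegal (P : RelSet.{u}) (N : Set ZFSet.{u}) (q p : Ordinal.{u} → ZFSet.{u})
    (i : Ordinal.{u}) : Prop where
  q_mem : q i ∈ P.carrier
  q_mem_model : q i ∈ N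
  p_mem : p i ∈ P.carrier
  q_le_p : P.le (q i) (p i)
  increasing : ∀ j < i, P.le (q j) (q i) ∧ P.le (p j) (p i)

/-- She wins the play `⟨q i, p i : i < θ⟩`. -/
def MWin (P : RelSet.{u}) (N : Set ZFSet.{u}) (θ : Cardinal.{u})
    (q p : Ordinal.{u} → ZFSet.{u}) : Prop :=
  ∀ pθ qθ, P.IsLeastUpperBound (p '' Set.Iio θ.ord) pθ →
    P.IsLeastUpperBound (q '' Set.Iio θ.ord) qθ →
    ∀ q' ∈ P.carrier, q' ∈ N → P.le qθ q' → P.Compatible q' pθ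

/-- A strategy: the next pair `(q i, p i)` as a function of the pairs played so far. -/
abbrev MStrategy : Type (u + 1) :=
  (i : Ordinal.{u}) → (Set.Iio i → ZFSet.{u} × ZFSet.{u}) → ZFSet.{u} × ZFSet.{u}

/-- The move at stage `i` is the one told by the strategy `st`. -/
def MFollows (st : MStrategy.{u}) (q p : Ordinal.{u} → ZFSet.{u}) (i : Ordinal.{u}) : Prop :=
  (q i, p i) = st i (fun j => (q j, p j))

/-- She, who moves at odd stages, has a winning strategy in the game of length `θ`. As long as She
follows it and He moves legally at the even stages (limit stages are even), Her moves are legal, and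
She wins every play that lasts `θ` moves. The parity of `i` is the remainder in `i = 2 * β + r`. -/
def SheWins (P : RelSet.{u}) (N : Set ZFSet.{u}) (θ : Cardinal.{u}) : Prop :=
  ∃ st : MStrategy.{u}, ∀ q p : Ordinal.{u} → ZFSet.{u}, ∀ δ ≤ θ.ord,
    (∀ i < δ, i % 2 = 0 → MLegal P N q p i) → (∀ i < δ, i % 2 = 1 → MFollows st q p i) →
      (∀ i < δ, i % 2 = 1 → MLegal P N q p i) ∧ (δ = θ.ord → MWin P N θ q p)

/-! ### Manageability -/

/-- Weak `(θ, μ, κ)`-manageability: `P` is `θ⁺`-lub-complete and for every sufficiently large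
regular `χ` and every well-ordering `<*` of `H(χ)` there is a witness `x ∈ H(χ)` such that She has
a winning strategy for every `(P, κ, μ)`-relevant `N ≺ (H(χ), ∈, <*)` with `x ∈ N`. -/
def WeaklyManageable (P : RelSet.{u}) (θ μ κ : Cardinal.{u}) : Prop :=
  P.LubComplete (Order.succ θ) ∧
  ∃ χ₀ : Cardinal.{u}, ∀ χ ≥ χ₀, χ.IsRegular →
    ∀ lt : HSet χ → HSet χ → Prop, IsWellOrder (HSet χ) lt →
      ∃ x, InH χ x ∧ ∀ N : Submodel χ lt,
        IsRelevant P κ μ N.sets → x ∈ N.sets → SheWins P N.sets θ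

/-- `(θ, μ, κ)`-manageability. -/
structure Manageable (P : RelSet.{u}) (θ μ κ : Cardinal.{u}) : Prop where
  complete : P.Complete κ
  weaklyManageable : WeaklyManageable P θ μ κ
  star : StarCondition P κ θ.ord

/-! ### The one-step forcing -/

/-- The product `∏_{β < δ} μ β`: all functions `s` with domain `δ` and `s(β) < μ β`. -/
def seqs (μ : Ordinal.{u} → Cardinal.{u}) (δ : Ordinal.{u}) : ZFSet.{u} :=
  ZFSet.sep (fun s => ∀ β < δ, ∀ v, ZFSet.pair β.toZFSet v ∈ s → v ∈ cardSet (μ β))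
    (ZFSet.funs δ.toZFSet (ZFSet.iUnion fun β : Set.Iio δ => cardSet (μ β)))

/-- The restriction of the function `s` to the ordinal `α`. -/
def restr (s : ZFSet.{u}) (α : Ordinal.{u}) : ZFSet.{u} :=
  ZFSet.sep (fun z => ∃ x ∈ α.toZFSet, ∃ v, z = ZFSet.pair x v) s

/-- `T(U) = {η ↾ α : α < τ, η ∈ U}` (all these are subsets of `⋃ U`). -/
def tree (τ : Cardinal.{u}) (U : ZFSet.{u}) : ZFSet.{u} :=
  ZFSet.sep (fun σ => ∃ η ∈ U, ∃ α < τ.ord, σ = restr η α) (ZFSet.powerset (ZFSet.sUnion U))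

/-- The tuple `(i, U, f, g)` as a set. -/
def tuple (i : Ordinal.{u}) (U f g : ZFSet.{u}) : ZFSet.{u} :=
  ZFSet.pair i.toZFSet (ZFSet.pair U (ZFSet.pair f g))

/-- `(i, U, f, g)` is a condition: `i < κ`, `U` is a subset of `∏_{α<τ} μ α` of size less than `κ`,
`f = ⟨f_σ : σ ∈ T(U)⟩` with `f_σ : i → κ`, `g : U → i + 1`, and if `η ∈ U` and `g(η) ≤ j < i`, then
`π_η(j) < sup {f_{η ↾ α}(j) : α < τ}`, that is, `π_η(j)` is an element of some `f_{η ↾ α}(j)`. -/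
structure IsCondition (κ τ : Cardinal.{u}) (μ : Ordinal.{u} → Cardinal.{u})
    (π : ZFSet.{u} → ZFSet.{u}) (i : Ordinal.{u}) (U f g : ZFSet.{u}) : Prop where
  lt : i < κ.ord
  subset : U ⊆ seqs μ τ.ord
  card_lt : U.card < κ
  f_fun : f ∈ ZFSet.funs (tree τ U) (ZFSet.funs i.toZFSet (cardSet κ))
  g_fun : g ∈ ZFSet.funs U (i + 1).toZFSet
  bound : ∀ η ∈ U, ∀ γ j : Ordinal.{u}, ZFSet.pair η γ.toZFSet ∈ g → γ ≤ j → j < i →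
    ∀ v, ZFSet.pair j.toZFSet v ∈ π η →
      ∃ α < τ.ord, ∃ s w, ZFSet.pair (restr η α) s ∈ f ∧ ZFSet.pair j.toZFSet w ∈ s ∧ v ∈ w

/-- The set of all conditions. -/
def QCarrier (κ τ : Cardinal.{u}) (μ : Ordinal.{u} → Cardinal.{u}) (π : ZFSet.{u} → ZFSet.{u}) :
    ZFSet.{u} :=
  ZFSet.sep (fun p => ∃ i U f g, p = tuple i U f g ∧ IsCondition κ τ μ π i U f g)
    ((cardSet κ).prod ((ZFSet.powerset (seqs μ τ.ord)).prod
      ((ZFSet.powerset ((tree τ (seqs μ τ.ord)).prod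
          (ZFSet.powerset ((cardSet κ).prod (cardSet κ))))).prod
        (ZFSet.powerset ((seqs μ τ.ord).prod (cardSet κ))))))

/-- The order: `p ≤ q` iff `i^p ≤ i^q`, `U^p ⊆ U^q`, `g^p ⊆ g^q`, and `f^p_σ ⊆ f^q_σ` for all
`σ ∈ T(U^p)`. -/
def QLe (τ : Cardinal.{u}) (p q : ZFSet.{u}) : Prop :=
  ∃ i U f g i' U' f' g', p = tuple i U f g ∧ q = tuple i' U' f' g' ∧
    i ≤ i' ∧ U ⊆ U' ∧ g ⊆ g' ∧
    ∀ σ ∈ tree τ U, ∀ s s', ZFSet.pair σ s ∈ f → ZFSet.pair σ s' ∈ f' → s ⊆ s'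

/-- The one-step forcing `Q(π, μ, κ)`; the length of the sequence `μ` is `τ`. -/
def Q (κ τ : Cardinal.{u}) (μ : Ordinal.{u} → Cardinal.{u}) (π : ZFSet.{u} → ZFSet.{u}) :
    RelSet.{u} where
  carrier := QCarrier κ τ μ π
  rel := ZFSet.pairSep (QLe τ) (QCarrier κ τ μ π) (QCarrier κ τ μ π)

theorem tree_mono {τ : Cardinal.{u}} {U V : ZFSet.{u}} (h : U ⊆ V) : tree τ U ⊆ tree τ V := by
  intro σ hσ
  simp only [tree, ZFSet.mem_sep, ZFSet.mem_powerset] at hσ ⊢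
  obtain ⟨-, η, hη, α, hα, rfl⟩ := hσ
  refine ⟨fun z hz => ?_, η, h hη, α, hα, rfl⟩
  exact ZFSet.mem_sUnion.2 ⟨η, h hη, (ZFSet.mem_sep.1 hz).1⟩

theorem prod_mono {a b c d : ZFSet.{u}} (h : a ⊆ b) (h' : c ⊆ d) : a.prod c ⊆ b.prod d := by
  intro z hz
  obtain ⟨x, hx, y, hy, rfl⟩ := ZFSet.mem_prod.1 hz
  exact ZFSet.mem_prod.2 ⟨x, h hx, y, h' hy, rfl⟩

/-- The bounding set in `QCarrier` excludes nothing. -/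
theorem mem_QCarrier {κ τ : Cardinal.{u}} {μ : Ordinal.{u} → Cardinal.{u}}
    {π : ZFSet.{u} → ZFSet.{u}} {p : ZFSet.{u}} :
    p ∈ QCarrier κ τ μ π ↔
      ∃ i U f g, p = tuple i U f g ∧ IsCondition κ τ μ π i U f g := by
  refine ⟨fun h => (ZFSet.mem_sep.1 h).2, fun h => ZFSet.mem_sep.2 ⟨?_, h⟩⟩
  obtain ⟨i, U, f, g, rfl, hc⟩ := h
  have hi : i.toZFSet ⊆ cardSet κ := Ordinal.toZFSet_subset_toZFSet_iff.2 hc.lt.le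
  simp only [tuple, ZFSet.pair_mem_prod, ZFSet.mem_powerset]
  refine ⟨Ordinal.toZFSet_mem_toZFSet_iff.2 hc.lt, hc.subset, ?_, ?_⟩
  · have hf := (ZFSet.mem_funs.1 hc.f_fun).1
    refine fun z hz => prod_mono (tree_mono hc.subset) (fun s hs => ?_) (hf hz)
    exact ZFSet.mem_powerset.2 fun y hy =>
      prod_mono hi (fun _ h => h) ((ZFSet.mem_funs.1 hs).1 hy)
  · have hg := (ZFSet.mem_funs.1 hc.g_fun).1
    refine fun z hz => prod_mono hc.subset ?_ (hg hz)
    exact Ordinal.toZFSet_subset_toZFSet_iff.2 (Order.add_one_le_of_lt hc.lt)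

/-! ### The functions added by the one-step forcing

The canonical name `f_σ` is the union of all `f^p_σ` for `p` in the generic filter with
`σ ∈ T(U^p)`. -/

/-- `p` forces that the generic filter meets `A`. -/
def RelSet.ForcesMeets (P : RelSet.{u}) (p : ZFSet.{u}) (A : Set ZFSet.{u}) : Prop :=
  ∀ q, P.le p q → ∃ r, P.le q r ∧ ∃ a ∈ A, P.le a r

/-- The conditions `a` with `σ ∈ T(U^a)` and `f^a_σ(j) = w`. The generic filter meets this set if
and only if `f_σ(j) = w` holds in the extension. -/
def valueSet (P : RelSet.{u}) (σ : ZFSet.{u}) (j : Ordinal.{u}) (w : ZFSet.{u}) :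
    Set ZFSet.{u} :=
  {a | a ∈ P.carrier ∧ ∃ i U f g s, a = tuple i U f g ∧ ZFSet.pair σ s ∈ f ∧
    ZFSet.pair j.toZFSet w ∈ s}

/-- It is forced that `f_σ` is a function from `κ` to `κ`: for every `j < κ` it is forced that
`f_σ(j) = w` for some `w < κ`, and no condition forces two different values. -/
def ForcedFunction (P : RelSet.{u}) (κ : Cardinal.{u}) (σ : ZFSet.{u}) : Prop :=
  ∀ j < κ.ord,
    (∀ p ∈ P.carrier, P.ForcesMeets p {a | ∃ w ∈ cardSet κ, a ∈ valueSet P σ j w}) ∧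
    ∀ w w', w ≠ w' → ∀ p ∈ P.carrier,
      ¬ (P.ForcesMeets p (valueSet P σ j w) ∧ P.ForcesMeets p (valueSet P σ j w'))

/-- It is forced that the family of all `f_σ`, for `σ ∈ ⋃_{α<τ} ∏_{β<α} μ β`, consists of
functions from `κ` to `κ` and `τ`-dominates the ground model functions: for every `h : κ → κ`
densely many conditions `r` have a set `S` of at most `τ` many indices such that, for all `j < κ`,
`r` forces `h(j) < sup {f_σ(j) : σ ∈ S}`. -/
def AddsDominatingFamily (P : RelSet.{u}) (κ τ : Cardinal.{u})
    (μ : Ordinal.{u} → Cardinal.{u}) : Prop :=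
  (∀ α < τ.ord, ∀ σ ∈ seqs μ α, ForcedFunction P κ σ) ∧
  ∀ h ∈ ZFSet.funs (cardSet κ) (cardSet κ), ∀ p ∈ P.carrier, ∃ r, P.le p r ∧
    ∃ S : ZFSet.{u}, (∀ σ ∈ S, ∃ α < τ.ord, σ ∈ seqs μ α) ∧ S.card ≤ τ ∧
      ∀ j < κ.ord, P.ForcesMeets r
        {a | ∃ σ ∈ S, ∃ w v, a ∈ valueSet P σ j w ∧ ZFSet.pair j.toZFSet v ∈ h ∧ v ∈ w}

end Manageability

end

/-!
A condition of `Q` is determined by its height `i`, its set `U` of branches, the values `f_σ(j)` at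
the nodes `σ` of `U`, and the numbers `g(η)`. The structure `Cond` holds these data, with total
functions for `f` and `g`, and `mem_carrier_iff` and `toSet_le` translate between it and the sets of
pairs that make up `Q`. The order is antisymmetric, so least upper bounds are unique: they are
unions (`exists_union`). Two constructions of conditions carry everything else.

* `exists_extension`: new branches can be added, with `g(η)` equal to the present height for each of
  them, and the height can be increased, since `f_σ(j)` for new `j` may exceed `π_η(j)` for all
  branches `η` at once.
* `exists_amalgam`: two conditions that agree on their common domain have a common extension, if
  each branch of the lower one that is missing in the higher one has a node which is not a node of
  the higher one. The value at such a node meets the requirement on the branch between the two heights.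

*Domination.* Given `h = π_η`, put `η` into the condition. From its height on, `h` is below the
supremum over the nodes of `η`. Below its height, `h` is beaten by the value at one further node,
on a branch that leaves the tree of the condition at its first step. So `τ` many nodes suffice.

*The game on `κ⁺` conditions.* Player I plays unions, and codes his conditions by a regressive
function (`exists_regressive`, a counting form of the Δ-system lemma that uses `2 ^< κ = κ`). On a
club and at points of cofinality `κ`, conditions with the same code have the same height and agree
on their common domain. At the end of the play this passes to the unions, which therefore have a
common extension.

*Manageability.* The required closure properties of `N` have the form "`d ∈ N` and `R d y` imply
`y ∈ N`" for one relation `R` that relates each set to at most `κ` many others. A single parameter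
in `N` enforces them, as `κ ⊆ N` (`exists_closure_parameter`). Given `q ∈ N` below `p`, She adds to
`p` a branch in `N` through each node of `p` in `N`, and answers with the result and its restriction
to `N`, which is in `N` since `N` is closed under sequences of length less than `κ` and there are
only `κ` many conditions with a given set of branches. At the end, `p_θ` agrees with every
`q ∈ N` above `q_θ` at their common nodes. A branch of `p_θ` missing in `q` is not in `N`, hence
has a node outside `N`, and all nodes of `q` are in `N`. So the two conditions can be amalgamated.
-/

namespace Manageability

/-! ### Cardinal arithmetic -/

theorem exists_lt_of_card_lt_cof {o : Ordinal.{u}} {T : Type (u + 1)}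
    (hT : #T < lift.{u + 1} o.cof) (f : T → Ordinal.{u}) (hf : ∀ t, f t < o) :
    ∃ b < o, ∀ t, f t ≤ b := by
  have hs : Small.{u} T := by
    rw [small_iff_lift_mk_lt_univ]
    rw [Cardinal.lift_id]
    exact hT.trans (Cardinal.lift_lt_univ _)
  refine ⟨⨆ t, f t, Ordinal.lift_iSup_lt_of_lt_cof ?_ hf, fun t => Ordinal.le_iSup f t⟩
  rw [← Ordinal.lift_cof]
  rw [Cardinal.lift_id'.{u, u + 1}]
  exact hT

theorem exists_lt_of_card_lt {c : Cardinal.{u}} (hc : c.IsRegular) {T : Type (u + 1)}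
    (hT : #T < lift.{u + 1} c) (f : T → Ordinal.{u}) (hf : ∀ t, f t < c.ord) :
    ∃ b < c.ord, ∀ t, f t ≤ b :=
  exists_lt_of_card_lt_cof (by rwa [hc.cof_ord]) f hf

theorem mk_Iio_ord (c : Cardinal.{u}) : #(Set.Iio c.ord) = lift.{u + 1} c := by
  rw [Cardinal.mk_Iio_ordinal, card_ord]

/-- If `κ` is regular with `2 ^< κ = κ`, then a set of size at most `κ` has at most `κ` many
subsets of size less than `κ`. -/
theorem exists_code_of_small_subsets {κ : Cardinal.{u}} (hκ : κ.IsRegular)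
    (hpow : (2 : Cardinal.{u}) ^< κ = κ) {T : Type (u + 1)} (Z : Set T)
    (hZ : #Z ≤ lift.{u + 1} κ) :
    ∃ c : Set T → Ordinal.{u}, (∀ s, c s < κ.ord) ∧
      Set.InjOn c {s | s ⊆ Z ∧ #s < lift.{u + 1} κ} := by
  -- an injection of `Z` into `κ` turns small subsets of `Z` into bounded subsets of `κ`
  have h1 : #Z ≤ #(Set.Iio κ.ord) := by rwa [mk_Iio_ord]
  obtain ⟨e⟩ := h1
  have hbd : ∀ s : Set T, s ⊆ Z → #s < lift.{u + 1} κ →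
      ∃ b : Set.Iio κ.ord, ∀ z : Z, z.1 ∈ s → e z ≤ b := by
    intro s hs hsc
    obtain ⟨b, hb, hb'⟩ := exists_lt_of_card_lt hκ hsc
      (fun t : s => (e ⟨t, hs t.2⟩ : Ordinal)) (fun t => (e ⟨t, hs t.2⟩).2)
    exact ⟨⟨b, hb⟩, fun z hz => hb' ⟨z, hz⟩⟩
  have hcount : #(Σ b : Set.Iio κ.ord, Set (Set.Iic b)) ≤ #(Set.Iio κ.ord) := by
    rw [mk_sigma, mk_Iio_ord]
    refine (Cardinal.sum_le_sum _ (fun _ => lift.{u + 1} κ) fun b => ?_).trans ?_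
    · rw [mk_set]
      have h2 : #(Set.Iic b) < lift.{u + 1} κ := by
        have h3 : #(Set.Iic b) ≤ #(Set.Iio (Order.succ b.1)) := by
          refine Cardinal.mk_le_of_injective (f := fun x => ⟨x.1.1, ?_⟩) ?_
          · exact Order.lt_succ_of_le (show x.1.1 ≤ b.1 from x.2)
          · intro x y h
            simpa [Subtype.ext_iff] using h
        refine h3.trans_lt ?_
        rw [Cardinal.mk_Iio_ordinal, Cardinal.lift_lt]
        refine lt_ord.1 ?_
        exact (isSuccLimit_ord hκ.aleph0_le).succ_lt b.2
      obtain ⟨d, hd⟩ := Cardinal.mem_range_lift_of_le (h2.le)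
      rw [← hd] at h2 ⊢
      have h4 : d < κ := Cardinal.lift_lt.1 h2
      have := le_powerlt (2 : Cardinal.{u}) h4
      rw [hpow] at this
      rw [← lift_two.{u + 1, u}, ← lift_power]
      exact Cardinal.lift_le.2 this
    · rw [Cardinal.sum_const', mk_Iio_ord, Cardinal.mul_eq_self]
      simpa using hκ.aleph0_le
  obtain ⟨k⟩ := hcount
  classical
  let b0 : Set.Iio κ.ord := ⟨0, hκ.ord_pos⟩
  let bd : Set T → Set.Iio κ.ord := fun s =>
    if h : s ⊆ Z ∧ #s < lift.{u + 1} κ then (hbd s h.1 h.2).choose else b0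
  refine ⟨fun s => k ⟨bd s, {x | ∃ z : Z, z.1 ∈ s ∧ e z = x.1}⟩, fun s => (k _).2, ?_⟩
  intro s hs t ht hst
  have h5 := k.injective (Subtype.ext hst)
  have key : ∀ s, (s ⊆ Z ∧ #s < lift.{u + 1} κ) → ∀ z : Z, z.1 ∈ s → e z ≤ bd s := by
    intro s hs z hz
    simp only [bd, dif_pos hs]
    exact (hbd s hs.1 hs.2).choose_spec z hz
  have h6 : ∀ s t, (s ⊆ Z ∧ #s < lift.{u + 1} κ) →
      (⟨bd s, {x | ∃ z : Z, z.1 ∈ s ∧ e z = x.1}⟩ : Σ b : Set.Iio κ.ord, Set (Set.Iic b)) =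
        ⟨bd t, {x | ∃ z : Z, z.1 ∈ t ∧ e z = x.1}⟩ → s ⊆ t := by
    intro s t hs heq z hz
    rw [Sigma.mk.inj_iff] at heq
    obtain ⟨ha, hb⟩ := heq
    have hle := key s hs ⟨z, hs.1 hz⟩ hz
    revert hb
    generalize bd t = bt at ha
    subst ha
    intro hb
    have hb := eq_of_heq hb
    have : (⟨e ⟨z, hs.1 hz⟩, hle⟩ : Set.Iic (bd s)) ∈
        {x : Set.Iic (bd s) | ∃ z : Z, z.1 ∈ s ∧ e z = x.1} := ⟨⟨z, hs.1 hz⟩, hz, rfl⟩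
    rw [hb] at this
    obtain ⟨z', hz', hze⟩ := this
    have := congrArg Subtype.val (e.injective hze)
    simp only at this
    exact this ▸ hz'
  exact Set.Subset.antisymm (h6 s t hs h5) (h6 t s ht h5.symm)

/-! ### Clubs and regressive functions on `κ⁺` -/

theorem Idx.exists_gt {κ : Cardinal.{u}} (hκ : ℵ₀ ≤ κ) {T : Type (u + 1)}
    (hT : #T ≤ lift.{u + 1} κ) (f : T → Idx κ) : ∃ b : Idx κ, ∀ t, f t < b := by
  have hr := isRegular_succ hκ
  obtain ⟨b, hb, h⟩ := exists_lt_of_card_lt hr (hT.trans_lt (Cardinal.lift_lt.2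
    (Order.lt_succ κ))) (fun t => (f t : Ordinal)) (fun t => (f t).2)
  refine ⟨⟨Order.succ b, (isSuccLimit_ord hr.aleph0_le).succ_lt hb⟩, fun t => ?_⟩
  exact Order.lt_succ_of_le (h t)

theorem Idx.mk_Iio_le {κ : Cardinal.{u}} (b : Idx κ) : #(Set.Iio b) ≤ lift.{u + 1} κ := by
  have h3 : #(Set.Iio b) ≤ #(Set.Iio b.1) := by
    refine Cardinal.mk_le_of_injective (f := fun x => ⟨x.1.1, x.2⟩) ?_
    intro x y h
    simpa [Subtype.ext_iff] using h
  refine h3.trans ?_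
  rw [Cardinal.mk_Iio_ordinal, Cardinal.lift_le, ← Order.lt_succ_iff]
  exact lt_ord.1 b.2

/-- The closure points of a function on `κ⁺` form a club. -/
theorem Idx.isClub_closurePoints {κ : Cardinal.{u}} (hκ : ℵ₀ ≤ κ) (h : Idx κ → Idx κ) :
    IsClub {i : Idx κ | ∀ β < i, h β ≤ i} := by
  refine ⟨?_, fun a => ?_⟩
  · intro s hs _ _ a ha β hβ
    obtain ⟨x, hx, hβx⟩ := (lt_isLUB_iff ha).1 hβ
    exact (hs hx β hβx).trans (ha.1 hx)
  · -- iterate a bound of `h` on initial segments `ω` many times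
    have hstep : ∀ a : Idx κ, ∃ b, a < b ∧ ∀ β < a, h β < b := by
      intro a
      have hle : #(Option (Set.Iio a)) ≤ lift.{u + 1} κ := by
        rw [mk_option]
        have h1 : ℵ₀ ≤ lift.{u + 1} κ := by simpa using hκ
        exact add_le_of_le h1 (Idx.mk_Iio_le a) (one_le_aleph0.trans h1)
      obtain ⟨b, hb⟩ := Idx.exists_gt hκ hle (fun o => o.elim a fun β => h β)
      exact ⟨b, hb none, fun β hβ => hb (some ⟨β, hβ⟩)⟩
    choose S hS1 hS2 using hstep
    let g : ℕ → Idx κ := fun n => S^[n] a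
    have hg : ∀ n, g (n + 1) = S (g n) := fun n => Function.iterate_succ_apply' S n a
    have hT : #(ULift.{u + 1} ℕ) ≤ lift.{u + 1} κ := by simpa using hκ
    obtain ⟨c, hc⟩ := Idx.exists_gt hκ hT (fun n => g n.down)
    have hne : {b : Idx κ | ∀ n, g n ≤ b}.Nonempty := ⟨c, fun n => (hc ⟨n⟩).le⟩
    have hmin := WellFounded.min_mem (wellFounded_lt (α := Idx κ)) _ hne
    set m := (wellFounded_lt (α := Idx κ)).min _ hne
    refine ⟨m, fun β hβ => ?_, hmin 0⟩
    have : ∃ n, β < g n := by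
      by_contra! hcon
      exact WellFounded.not_lt_min (wellFounded_lt (α := Idx κ)) _
        (show β ∈ {b : Idx κ | ∀ n, g n ≤ b} from hcon) hβ
    obtain ⟨n, hn⟩ := this
    exact (hS2 _ _ hn).le.trans ((hg n).symm.le.trans (hmin (n + 1)))

/-- The combinatorial heart of the chain condition. For `κ⁺` many sets of pairs, each of size less
than `κ` and with second coordinates in a set of size at most `κ`, a regressive function records
enough of the sets so that, on a club and at points of cofinality `κ`, equal values imply that the
two sets have the same fibres over common first coordinates. -/
theorem exists_regressive {κ : Cardinal.{u}} (hκ : κ.IsRegular)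
    (hpow : (2 : Cardinal.{u}) ^< κ = κ) {X Y : Type (u + 1)} {W : Set Y}
    (hW : #W ≤ lift.{u + 1} κ) (B : Idx κ → Set (X × Y)) (hB : ∀ i, #(B i) < lift.{u + 1} κ)
    (hBW : ∀ i, ∀ z ∈ B i, z.2 ∈ W) :
    ∃ φ : Idx κ → Ordinal.{u}, (∀ i, φ i < 1 + (i : Ordinal.{u})) ∧
      ∃ C : Set (Idx κ), IsClub C ∧ ∀ i ∈ C, ∀ j ∈ C, i ≠ j →
        (i : Ordinal.{u}).cof = κ → (j : Ordinal.{u}).cof = κ → φ i = φ j →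
        ∀ x y y', (x, y) ∈ B i → (x, y') ∈ B j → (x, y) ∈ B j := by
  classical
  have hκ0 := hκ.aleph0_le
  have hlκ0 : ℵ₀ ≤ lift.{u + 1} κ := by simpa using hκ0
  have hr := isRegular_succ hκ0
  -- `e` enumerates all first coordinates in order type at most `κ⁺`
  let A : Set X := ⋃ i, Prod.fst '' B i
  have hA : #A ≤ #(Idx κ) := by
    refine (mk_iUnion_le_sum_mk).trans ?_
    refine (Cardinal.sum_le_sum _ (fun _ => lift.{u + 1} κ) fun i =>
      mk_image_le.trans (hB i).le).trans ?_
    rw [Cardinal.sum_const', mk_Iio_ord]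
    refine Cardinal.mul_le_of_le (aleph0_le_lift.2 hr.aleph0_le) le_rfl ?_
    exact Cardinal.lift_le.2 (Order.le_succ κ)
  obtain ⟨e⟩ := hA
  have hmemA : ∀ {i} {z : X × Y}, z ∈ B i → z.1 ∈ A := fun {i} {z} hz =>
    Set.mem_iUnion.2 ⟨i, z, hz, rfl⟩
  -- `low β` is the set of pairs with second coordinate in `W` and first coordinate enumerated
  -- before `β`
  let low : Idx κ → Set (X × Y) := fun β => {z | z.2 ∈ W ∧ ∃ h : z.1 ∈ A, e ⟨z.1, h⟩ < β}
  have hlow : ∀ β, #(low β) ≤ lift.{u + 1} κ := by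
    intro β
    have : #(low β) ≤ #(Set.Iio β × W) := by
      refine Cardinal.mk_le_of_injective
        (f := fun z => (⟨e ⟨z.1.1, z.2.2.choose⟩, z.2.2.choose_spec⟩, ⟨z.1.2, z.2.1⟩)) ?_
      intro z w h
      simp only [Prod.mk.injEq] at h
      have h1 := congrArg Subtype.val (e.injective (congrArg Subtype.val h.1))
      exact Subtype.ext (Prod.ext h1 (congrArg Subtype.val h.2))
    refine this.trans ?_
    rw [mk_prod, Cardinal.lift_id, Cardinal.lift_id]
    exact Cardinal.mul_le_of_le hlκ0 (Idx.mk_Iio_le β) hW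
  choose c hc hcinj using fun β => exists_code_of_small_subsets hκ hpow (low β) (hlow β)
  -- a bound for the positions of the first coordinates of `B β`, and for the codes at `β`
  have hh : ∀ β : Idx κ, ∃ b : Idx κ, κ.ord * (β : Ordinal) + κ.ord ≤ b ∧
      ∀ z, ∀ hz : z ∈ B β, e ⟨z.1, hmemA hz⟩ < b := by
    intro β
    have hlt : κ.ord * (β : Ordinal) + κ.ord < (Order.succ κ).ord := by
      have h1 : κ.ord < (Order.succ κ).ord := ord_lt_ord.2 (Order.lt_succ κ)
      exact (Ordinal.isPrincipal_add_ord hr.aleph0_le)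
        ((Ordinal.isPrincipal_mul_ord hr.aleph0_le) h1 β.2) h1
    have hle : #(Option (B β)) ≤ lift.{u + 1} κ := by
      rw [mk_option]
      exact add_le_of_le hlκ0 (hB β).le (one_le_aleph0.trans hlκ0)
    obtain ⟨b, hb⟩ := Idx.exists_gt hκ0 hle
      (fun o => o.elim ⟨_, hlt⟩ fun z => e ⟨z.1.1, hmemA z.2⟩)
    exact ⟨b, (hb none).le, fun z hz => hb (some ⟨z, hz⟩)⟩
  choose h hh1 hh2 using hh
  let tr : Idx κ → Set (X × Y) := fun i => B i ∩ low i
  let good : Idx κ → Idx κ → Prop := fun i β => β < i ∧ tr i ⊆ low β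
  let φ : Idx κ → Ordinal.{u} := fun i =>
    if H : ∃ β, good i β ∧ κ.ord * (β : Ordinal) + c β (tr i) < 1 + (i : Ordinal) then
      κ.ord * (H.choose : Ordinal) + c H.choose (tr i) else 0
  refine ⟨φ, fun i => ?_, {i | ∀ β < i, h β ≤ i}, Idx.isClub_closurePoints hκ0 h, ?_⟩
  · simp only [φ]
    split_ifs with H
    · exact H.choose_spec.2
    · exact (zero_lt_one).trans_le le_self_add
  have hval : ∀ i ∈ {i : Idx κ | ∀ β < i, h β ≤ i}, (i : Ordinal.{u}).cof = κ →
      ∃ β, tr i ⊆ low β ∧ φ i = κ.ord * (β : Ordinal) + c β (tr i) := by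
    intro i hi hcof
    have hex : ∃ β : Idx κ, good i β := by
      have hT : #(tr i) < lift.{u + 1} (i : Ordinal.{u}).cof := by
        rw [hcof]
        exact (mk_le_mk_of_subset Set.inter_subset_left).trans_lt (hB i)
      obtain ⟨b, hb, hb'⟩ := exists_lt_of_card_lt_cof hT
        (fun z => (e ⟨z.1.1, z.2.2.2.choose⟩ : Ordinal)) (fun z => z.2.2.2.choose_spec)
      have hlim : Order.IsSuccLimit (i : Ordinal.{u}) :=
        Ordinal.one_lt_cof_iff.1 (by rw [hcof]; exact one_lt_aleph0.trans_le hκ0)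
      refine ⟨⟨Order.succ b, (hlim.succ_lt hb).trans i.2⟩, hlim.succ_lt hb, fun z hz => ?_⟩
      exact ⟨hz.2.1, hz.2.2.choose, Order.lt_succ_of_le (hb' ⟨z, hz⟩)⟩
    obtain ⟨β, hβ⟩ := hex
    have H : ∃ β, good i β ∧ κ.ord * (β : Ordinal) + c β (tr i) < 1 + (i : Ordinal) := by
      refine ⟨β, hβ, ?_⟩
      have h1 : κ.ord * (β : Ordinal) + c β (tr i) < κ.ord * (β : Ordinal) + κ.ord :=
        by simpa using hc β (tr i)
      refine h1.trans_le ((hh1 β).trans ?_)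
      have h2 : (h β : Ordinal) ≤ i := hi β hβ.1
      exact h2.trans (le_add_self)
    refine ⟨H.choose, H.choose_spec.1.2, ?_⟩
    simp only [φ, dif_pos H]
  have htr : ∀ i ∈ {i : Idx κ | ∀ β < i, h β ≤ i}, ∀ j ∈ {i : Idx κ | ∀ β < i, h β ≤ i},
      (i : Ordinal.{u}).cof = κ → (j : Ordinal.{u}).cof = κ → φ i = φ j → tr i = tr j := by
    intro i hi j hj hci hcj hφ
    obtain ⟨β, hβ, e1⟩ := hval i hi hci
    obtain ⟨γ, hγ, e2⟩ := hval j hj hcj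
    rw [e1, e2] at hφ
    have hk : κ.ord ≠ 0 := hκ.ord_pos.ne'
    have h1 := congrArg (· / κ.ord) hφ
    simp only [Ordinal.mul_add_div _ hk, Ordinal.div_eq_zero_of_lt (hc _ _), add_zero] at h1
    have h1 : β = γ := Subtype.ext h1
    subst h1
    refine hcinj β ⟨hβ, ?_⟩ ⟨hγ, ?_⟩ (by simpa using hφ)
    · exact (mk_le_mk_of_subset Set.inter_subset_left).trans_lt (hB i)
    · exact (mk_le_mk_of_subset Set.inter_subset_left).trans_lt (hB j)
  intro i hi j hj hne hci hcj hφ x y y' hxi hxj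
  have ht := htr i hi j hj hci hcj hφ
  -- for `i < j`, first coordinates of `B i` are enumerated before `j`
  rcases lt_or_gt_of_ne hne with hij | hij
  · have h1 : (x, y') ∈ tr j := ⟨hxj, hBW j _ hxj, hmemA hxj, (hh2 i _ hxi).trans_le (hj i hij)⟩
    rw [← ht] at h1
    obtain ⟨_, _, hA', hlt⟩ := h1
    have h2 : (x, y) ∈ tr i := ⟨hxi, hBW i _ hxi, hA', hlt⟩
    rw [ht] at h2
    exact h2.1
  · have h1 : (x, y) ∈ tr i := ⟨hxi, hBW i _ hxi, hmemA hxi, (hh2 j _ hxj).trans_le (hi j hij)⟩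
    rw [ht] at h1
    exact h1.1

/-! ### Functions as sets -/

/-- The function with domain `A` and values `h a`, as a set of pairs. -/
noncomputable def lam (A : ZFSet.{u}) (h : ZFSet.{u} → ZFSet.{u}) : ZFSet.{u} :=
  ZFSet.range fun a : A => ZFSet.pair a (h a)

/-- The sequence `⟨h j : j < δ⟩`, as a set of pairs. -/
noncomputable def lamO (δ : Ordinal.{u}) (h : Ordinal.{u} → ZFSet.{u}) : ZFSet.{u} :=
  ZFSet.range fun j : Set.Iio δ => ZFSet.pair j.1.toZFSet (h j)

section Functions

variable {A B : ZFSet.{u}} {h h' : ZFSet.{u} → ZFSet.{u}} {δ δ' : Ordinal.{u}}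
  {k k' : Ordinal.{u} → ZFSet.{u}}

theorem mem_lam {z : ZFSet.{u}} : z ∈ lam A h ↔ ∃ a ∈ A, z = ZFSet.pair a (h a) := by
  simp only [lam, ZFSet.mem_range, Subtype.exists, eq_comm, exists_prop]

theorem mem_lamO {z : ZFSet.{u}} :
    z ∈ lamO δ k ↔ ∃ j < δ, z = ZFSet.pair j.toZFSet (k j) := by
  simp only [lamO, ZFSet.mem_range, Subtype.exists, eq_comm, exists_prop, Set.mem_Iio]

theorem pair_mem_lam {a v : ZFSet.{u}} : ZFSet.pair a v ∈ lam A h ↔ a ∈ A ∧ v = h a := by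
  rw [mem_lam]
  constructor
  · rintro ⟨b, hb, e⟩
    obtain ⟨rfl, rfl⟩ := ZFSet.pair_inj.1 e
    exact ⟨hb, rfl⟩
  · rintro ⟨ha, rfl⟩
    exact ⟨a, ha, rfl⟩

theorem pair_mem_lamO {j : Ordinal.{u}} {v : ZFSet.{u}} :
    ZFSet.pair j.toZFSet v ∈ lamO δ k ↔ j < δ ∧ v = k j := by
  rw [mem_lamO]
  constructor
  · rintro ⟨b, hb, e⟩
    obtain ⟨e1, rfl⟩ := ZFSet.pair_inj.1 e
    obtain rfl := Ordinal.toZFSet_injective e1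
    exact ⟨hb, rfl⟩
  · rintro ⟨ha, rfl⟩
    exact ⟨j, ha, rfl⟩

theorem lam_mem_funs (hB : ∀ a ∈ A, h a ∈ B) : lam A h ∈ ZFSet.funs A B := by
  rw [ZFSet.mem_funs]
  refine ⟨fun z hz => ?_, fun a ha => ⟨h a, pair_mem_lam.2 ⟨ha, rfl⟩, fun v hv =>
    (pair_mem_lam.1 hv).2⟩⟩
  obtain ⟨a, ha, rfl⟩ := mem_lam.1 hz
  exact ZFSet.pair_mem_prod.2 ⟨ha, hB a ha⟩

theorem lamO_mem_funs (hB : ∀ j < δ, k j ∈ B) : lamO δ k ∈ ZFSet.funs δ.toZFSet B := by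
  rw [ZFSet.mem_funs]
  refine ⟨fun z hz => ?_, fun a ha => ?_⟩
  · obtain ⟨j, hj, rfl⟩ := mem_lamO.1 hz
    exact ZFSet.pair_mem_prod.2 ⟨Ordinal.toZFSet_mem_toZFSet_iff.2 hj, hB j hj⟩
  · obtain ⟨j, hj, rfl⟩ := Ordinal.mem_toZFSet_iff.1 ha
    exact ⟨k j, pair_mem_lamO.2 ⟨hj, rfl⟩, fun v hv => (pair_mem_lamO.1 hv).2⟩

theorem exists_eq_lam {f : ZFSet.{u}} (hf : f ∈ ZFSet.funs A B) :
    ∃ h : ZFSet.{u} → ZFSet.{u}, (∀ a ∈ A, h a ∈ B) ∧ f = lam A h := by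
  obtain ⟨hsub, huniq⟩ := ZFSet.mem_funs.1 hf
  have hex : ∀ a, ∃ b, a ∈ A → ZFSet.pair a b ∈ f ∧ ∀ y, ZFSet.pair a y ∈ f → y = b := by
    intro a
    by_cases ha : a ∈ A
    · obtain ⟨b, hb⟩ := huniq a ha
      exact ⟨b, fun _ => hb⟩
    · exact ⟨∅, fun h => absurd h ha⟩
  choose h hh using hex
  refine ⟨h, fun a ha => (ZFSet.pair_mem_prod.1 (hsub (hh a ha).1)).2, ?_⟩
  ext z
  rw [mem_lam]
  constructor
  · intro hz
    obtain ⟨a, ha, b, hb, rfl⟩ := ZFSet.mem_prod.1 (hsub hz)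
    exact ⟨a, ha, by rw [(hh a ha).2 b hz]⟩
  · rintro ⟨a, ha, rfl⟩
    exact (hh a ha).1

theorem lam_toZFSet : lam δ.toZFSet h = lamO δ fun j => h j.toZFSet := by
  ext z
  rw [mem_lam, mem_lamO]
  constructor
  · rintro ⟨a, ha, rfl⟩
    obtain ⟨j, hj, rfl⟩ := Ordinal.mem_toZFSet_iff.1 ha
    exact ⟨j, hj, rfl⟩
  · rintro ⟨j, hj, rfl⟩
    exact ⟨_, Ordinal.toZFSet_mem_toZFSet_iff.2 hj, rfl⟩

theorem exists_eq_lamO {f : ZFSet.{u}} (hf : f ∈ ZFSet.funs δ.toZFSet B) :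
    ∃ k : Ordinal.{u} → ZFSet.{u}, (∀ j < δ, k j ∈ B) ∧ f = lamO δ k := by
  obtain ⟨h, hB, rfl⟩ := exists_eq_lam hf
  exact ⟨fun j => h j.toZFSet, fun j hj => hB _ (Ordinal.toZFSet_mem_toZFSet_iff.2 hj),
    lam_toZFSet⟩

theorem lam_congr (e : ∀ a ∈ A, h a = h' a) : lam A h = lam A h' := by
  ext z
  rw [mem_lam, mem_lam]
  exact exists_congr fun a => and_congr_right fun ha => by rw [e a ha]

theorem lamO_congr (e : ∀ j < δ, k j = k' j) : lamO δ k = lamO δ k' := by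
  ext z
  rw [mem_lamO, mem_lamO]
  exact exists_congr fun a => and_congr_right fun ha => by rw [e a ha]

theorem lam_subset_lam {A' : ZFSet.{u}} (hA : A ⊆ A') :
    lam A h ⊆ lam A' h' ↔ ∀ a ∈ A, h a = h' a := by
  constructor
  · intro hs a ha
    exact (pair_mem_lam.1 (hs (pair_mem_lam.2 ⟨ha, rfl⟩))).2
  · intro hs z hz
    obtain ⟨a, ha, rfl⟩ := mem_lam.1 hz
    exact pair_mem_lam.2 ⟨hA ha, hs a ha⟩

theorem lamO_subset_lamO (hδ : δ ≤ δ') :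
    lamO δ k ⊆ lamO δ' k' ↔ ∀ j < δ, k j = k' j := by
  constructor
  · intro hs j hj
    exact (pair_mem_lamO.1 (hs (pair_mem_lamO.2 ⟨hj, rfl⟩))).2
  · intro hs z hz
    obtain ⟨j, hj, rfl⟩ := mem_lamO.1 hz
    exact pair_mem_lamO.2 ⟨hj.trans_le hδ, hs j hj⟩

theorem lamO_inj (e : lamO δ k = lamO δ k') {j : Ordinal.{u}} (hj : j < δ) : k j = k' j :=
  (lamO_subset_lamO le_rfl).1 (e ▸ fun _ hz => hz) j hj

end Functions

/-! ### Branches and nodes -/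

section Tree

variable {τ : Cardinal.{u}} {μ : Ordinal.{u} → Cardinal.{u}}

theorem mem_restr {s z : ZFSet.{u}} {α : Ordinal.{u}} :
    z ∈ restr s α ↔ z ∈ s ∧ ∃ j < α, ∃ v, z = ZFSet.pair j.toZFSet v := by
  rw [restr, ZFSet.mem_sep]
  refine and_congr_right fun _ => ⟨?_, ?_⟩
  · rintro ⟨x, hx, v, rfl⟩
    obtain ⟨j, hj, rfl⟩ := Ordinal.mem_toZFSet_iff.1 hx
    exact ⟨j, hj, v, rfl⟩
  · rintro ⟨j, hj, v, rfl⟩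
    exact ⟨_, Ordinal.toZFSet_mem_toZFSet_iff.2 hj, v, rfl⟩

theorem restr_lamO {δ α : Ordinal.{u}} (hα : α ≤ δ) (k : Ordinal.{u} → ZFSet.{u}) :
    restr (lamO δ k) α = lamO α k := by
  ext z
  rw [mem_restr, mem_lamO, mem_lamO]
  constructor
  · rintro ⟨⟨j, hj, rfl⟩, i, hi, v, e⟩
    obtain ⟨e1, rfl⟩ := ZFSet.pair_inj.1 e
    obtain rfl := Ordinal.toZFSet_injective e1
    exact ⟨j, hi, rfl⟩
  · rintro ⟨j, hj, rfl⟩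
    exact ⟨⟨j, hj.trans_le hα, rfl⟩, j, hj, _, rfl⟩

theorem mem_seqs {δ : Ordinal.{u}} {s : ZFSet.{u}} :
    s ∈ seqs μ δ ↔ ∃ k, (∀ β < δ, k β ∈ cardSet (μ β)) ∧ s = lamO δ k := by
  rw [seqs, ZFSet.mem_sep]
  constructor
  · rintro ⟨hs, h⟩
    obtain ⟨k, -, rfl⟩ := exists_eq_lamO hs
    exact ⟨k, fun β hβ => h β hβ _ (pair_mem_lamO.2 ⟨hβ, rfl⟩), rfl⟩
  · rintro ⟨k, hk, rfl⟩
    refine ⟨lamO_mem_funs fun β hβ => ZFSet.mem_iUnion.2 ⟨⟨β, hβ⟩, hk β hβ⟩, fun β hβ v hv => ?_⟩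
    rw [(pair_mem_lamO.1 hv).2]
    exact hk β hβ

theorem restr_mem_seqs {δ α : Ordinal.{u}} {s : ZFSet.{u}} (hs : s ∈ seqs μ δ) (hα : α ≤ δ) :
    restr s α ∈ seqs μ α := by
  obtain ⟨k, hk, rfl⟩ := mem_seqs.1 hs
  exact mem_seqs.2 ⟨k, fun β hβ => hk β (hβ.trans_le hα), restr_lamO hα k⟩

theorem mem_tree {U σ : ZFSet.{u}} :
    σ ∈ tree τ U ↔ ∃ η ∈ U, ∃ α < τ.ord, σ = restr η α := by
  rw [tree, ZFSet.mem_sep, ZFSet.mem_powerset, and_iff_right_iff_imp]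
  rintro ⟨η, hη, α, -, rfl⟩ z hz
  exact ZFSet.mem_sUnion.2 ⟨η, hη, (mem_restr.1 hz).1⟩

theorem restr_mem_tree {U η : ZFSet.{u}} {α : Ordinal.{u}} (hη : η ∈ U) (hα : α < τ.ord) :
    restr η α ∈ tree τ U :=
  mem_tree.2 ⟨η, hη, α, hα, rfl⟩

theorem mem_tree_union {U V σ : ZFSet.{u}} :
    σ ∈ tree τ (U ∪ V) ↔ σ ∈ tree τ U ∨ σ ∈ tree τ V := by
  simp only [mem_tree, ZFSet.mem_union, or_and_right, exists_or]

/-- Sequences of limit length with the same proper initial segments are equal. -/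
theorem seqs_ext {δ : Ordinal.{u}} (hδ : Order.IsSuccLimit δ) {s t : ZFSet.{u}}
    (hs : s ∈ seqs μ δ) (ht : t ∈ seqs μ δ) (h : ∀ α < δ, restr s α = restr t α) : s = t := by
  obtain ⟨k, hk, rfl⟩ := mem_seqs.1 hs
  obtain ⟨k', hk', rfl⟩ := mem_seqs.1 ht
  refine lamO_congr fun j hj => ?_
  have h1 := h _ (hδ.succ_lt hj)
  rw [restr_lamO (hδ.succ_lt hj).le, restr_lamO (hδ.succ_lt hj).le] at h1
  exact lamO_inj h1 (Order.lt_succ j)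

/-- Every node of `∏_{β < α} μ β` extends to a branch. -/
theorem exists_branch {δ α : Ordinal.{u}} (hα : α ≤ δ) (hμ : ∀ β < δ, μ β ≠ 0) {σ : ZFSet.{u}}
    (hσ : σ ∈ seqs μ α) : ∃ η ∈ seqs μ δ, restr η α = σ := by
  classical
  obtain ⟨k, hk, rfl⟩ := mem_seqs.1 hσ
  refine ⟨lamO δ fun j => if j < α then k j else Ordinal.toZFSet 0, mem_seqs.2 ⟨_, ?_, rfl⟩, ?_⟩
  · intro β hβ
    split_ifs with hc
    · exact hk β hc
    · refine Ordinal.toZFSet_mem_toZFSet_iff.2 ?_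
      rw [pos_iff_ne_zero, Ne, ord_eq_zero]
      exact hμ β hβ
  · rw [restr_lamO hα]
    exact lamO_congr fun j hj => if_pos hj

end Tree

/-! ### Conditions -/

/-- The value of a function `f : κ → κ` at `j`, as an ordinal. The rank turns a von Neumann ordinal
into an ordinal. The value is meaningless if `j` is not in the domain of `f`. -/
noncomputable def val (f : ZFSet.{u}) (j : Ordinal.{u}) : Ordinal.{u} :=
  (Classical.epsilon fun v => ZFSet.pair j.toZFSet v ∈ f).rank

theorem val_spec {κ : Cardinal.{u}} {f : ZFSet.{u}}
    (hf : f ∈ ZFSet.funs (cardSet κ) (cardSet κ)) {j : Ordinal.{u}} (hj : j < κ.ord) :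
    val f j < κ.ord ∧ ∀ v, ZFSet.pair j.toZFSet v ∈ f ↔ v = (val f j).toZFSet := by
  obtain ⟨k, hk, rfl⟩ := exists_eq_lamO hf
  have h1 : (Classical.epsilon fun v => ZFSet.pair j.toZFSet v ∈ lamO κ.ord k) = k j := by
    have h2 := Classical.epsilon_spec (p := fun v => ZFSet.pair j.toZFSet v ∈ lamO κ.ord k)
      ⟨k j, pair_mem_lamO.2 ⟨hj, rfl⟩⟩
    exact (pair_mem_lamO.1 h2).2
  obtain ⟨a, ha, e⟩ := Ordinal.mem_toZFSet_iff.1 (hk j hj)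
  have h3 : val (lamO κ.ord k) j = a := by
    rw [val, h1, ← e, Ordinal.rank_toZFSet]
  rw [h3, e]
  exact ⟨ha, fun v => pair_mem_lamO.trans (and_iff_right hj)⟩

/-- The data of a condition: the height `i`, the set `U` of branches, the values `F σ j` of the
functions `f_σ`, and the function `G` on branches. The functions are total, but only the values of
`F` at nodes of `U` and ordinals below `i`, and of `G` on `U`, are relevant. -/
structure Cond where
  i : Ordinal.{u}
  U : ZFSet.{u}
  F : ZFSet.{u} → Ordinal.{u} → Ordinal.{u}
  G : ZFSet.{u} → Ordinal.{u}

namespace Cond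

/-- The condition `(i, U, f, g)` as a set. -/
noncomputable def toSet (τ : Cardinal.{u}) (d : Cond.{u}) : ZFSet.{u} :=
  tuple d.i d.U (lam (tree τ d.U) fun σ => lamO d.i fun j => (d.F σ j).toZFSet)
    (lam d.U fun η => (d.G η).toZFSet)

/-- The data `d` describe a condition. A supremum exceeds `π_η(j)` iff one of its terms does, whence
the form of `bound`. -/
structure Valid (κ τ : Cardinal.{u}) (μ : Ordinal.{u} → Cardinal.{u})
    (π : ZFSet.{u} → ZFSet.{u}) (d : Cond.{u}) : Prop where
  lt : d.i < κ.ord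
  subset : d.U ⊆ seqs μ τ.ord
  card_lt : d.U.card < κ
  F_lt : ∀ σ ∈ tree τ d.U, ∀ j < d.i, d.F σ j < κ.ord
  G_le : ∀ η ∈ d.U, d.G η ≤ d.i
  bound : ∀ η ∈ d.U, ∀ j, d.G η ≤ j → j < d.i →
    ∃ α < τ.ord, val (π η) j < d.F (restr η α) j

/-- The order of the forcing on the data. -/
structure Le (τ : Cardinal.{u}) (d d' : Cond.{u}) : Prop where
  i_le : d.i ≤ d'.i
  U_subset : d.U ⊆ d'.U
  G_eq : ∀ η ∈ d.U, d.G η = d'.G η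
  F_eq : ∀ σ ∈ tree τ d.U, ∀ j < d.i, d.F σ j = d'.F σ j

theorem Le.refl (τ : Cardinal.{u}) (d : Cond.{u}) : d.Le τ d :=
  ⟨le_rfl, fun _ h => h, fun _ _ => rfl, fun _ _ _ _ => rfl⟩

theorem Le.trans {τ : Cardinal.{u}} {a b c : Cond.{u}} (h : a.Le τ b) (h' : b.Le τ c) :
    a.Le τ c :=
  ⟨h.i_le.trans h'.i_le, fun _ hx => h'.U_subset (h.U_subset hx),
    fun η hη => (h.G_eq η hη).trans (h'.G_eq η (h.U_subset hη)),
    fun σ hσ j hj => (h.F_eq σ hσ j hj).trans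
      (h'.F_eq σ (tree_mono h.U_subset hσ) j (hj.trans_le h.i_le))⟩

theorem Le.toSet_eq {τ : Cardinal.{u}} {a b : Cond.{u}} (h : a.Le τ b) (h' : b.Le τ a) :
    a.toSet τ = b.toSet τ := by
  obtain ⟨i, U, F, G⟩ := a
  obtain ⟨i', U', F', G'⟩ := b
  obtain rfl : i = i' := le_antisymm h.i_le h'.i_le
  obtain rfl : U = U' := ZFSet.ext fun z => ⟨fun hz => h.U_subset hz, fun hz => h'.U_subset hz⟩
  have e1 : (lam (tree τ U) fun σ => lamO i fun j => (F σ j).toZFSet) =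
      lam (tree τ U) fun σ => lamO i fun j => (F' σ j).toZFSet :=
    lam_congr fun σ hσ => lamO_congr fun j hj => congrArg _ (h.F_eq σ hσ j hj)
  have e2 : (lam U fun η => (G η).toZFSet) = lam U fun η => (G' η).toZFSet :=
    lam_congr fun η hη => congrArg _ (h.G_eq η hη)
  simp only [toSet, e1, e2]

end Cond

theorem tuple_inj {i i' : Ordinal.{u}} {U U' f f' g g' : ZFSet.{u}}
    (h : tuple i U f g = tuple i' U' f' g') : i = i' ∧ U = U' ∧ f = f' ∧ g = g' := by
  simp only [tuple, ZFSet.pair_inj] at h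
  exact ⟨Ordinal.toZFSet_injective h.1, h.2⟩

section Conditions

variable {κ τ : Cardinal.{u}} {μ : Ordinal.{u} → Cardinal.{u}} {π : ZFSet.{u} → ZFSet.{u}}
  (hπ : Set.MapsTo π {η | η ∈ seqs μ τ.ord} {h | h ∈ ZFSet.funs (cardSet κ) (cardSet κ)})

include hπ in
theorem mem_carrier_iff {p : ZFSet.{u}} :
    p ∈ (Q κ τ μ π).carrier ↔ ∃ d : Cond.{u}, d.Valid κ τ μ π ∧ p = d.toSet τ := by
  refine mem_QCarrier.trans ⟨?_, ?_⟩
  · rintro ⟨i, U, f, g, rfl, hc⟩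
    obtain ⟨hf, hf1, ef⟩ := exists_eq_lam hc.f_fun
    obtain ⟨hg, hg1, eg⟩ := exists_eq_lam hc.g_fun
    have hF : ∀ σ, ∃ k : Ordinal.{u} → Ordinal.{u}, σ ∈ tree τ U →
        (∀ j < i, k j < κ.ord) ∧ hf σ = lamO i fun j => (k j).toZFSet := by
      intro σ
      by_cases hσ : σ ∈ tree τ U
      · obtain ⟨k, hk, e⟩ := exists_eq_lamO (hf1 σ hσ)
        refine ⟨fun j => (k j).rank, fun _ => ⟨fun j hj => ?_, e.trans (lamO_congr fun j hj => ?_)⟩⟩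
        · obtain ⟨a, ha, e'⟩ := Ordinal.mem_toZFSet_iff.1 (hk j hj)
          show (k j).rank < κ.ord
          rwa [← e', Ordinal.rank_toZFSet]
        · obtain ⟨a, ha, e'⟩ := Ordinal.mem_toZFSet_iff.1 (hk j hj)
          show k j = (k j).rank.toZFSet
          rw [← e', Ordinal.rank_toZFSet]
      · exact ⟨fun _ => 0, fun h => absurd h hσ⟩
    choose F hF using hF
    have hG : ∀ η, ∃ γ : Ordinal.{u}, η ∈ U → γ ≤ i ∧ hg η = γ.toZFSet := by
      intro η
      by_cases hη : η ∈ U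
      · obtain ⟨a, ha, e'⟩ := Ordinal.mem_toZFSet_iff.1 (hg1 η hη)
        exact ⟨a, fun _ => ⟨Order.lt_add_one_iff.1 ha, e'.symm⟩⟩
      · exact ⟨0, fun h => absurd h hη⟩
    choose G hG using hG
    have hfe : f = lam (tree τ U) fun σ => lamO i fun j => (F σ j).toZFSet :=
      ef.trans (lam_congr fun σ hσ => (hF σ hσ).2)
    have hge : g = lam U fun η => (G η).toZFSet :=
      eg.trans (lam_congr fun η hη => (hG η hη).2)
    refine ⟨⟨i, U, F, G⟩, ⟨hc.lt, hc.subset, hc.card_lt, fun σ hσ => (hF σ hσ).1,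
      fun η hη => (hG η hη).1, fun η hη j h1 h2 => ?_⟩, ?_⟩
    · have hv := val_spec (hπ (hc.subset hη)) (h2.trans hc.lt)
      obtain ⟨α, hα, s, w, hs, hw, hvw⟩ := hc.bound η hη (G η) j
        (by rw [hge]; exact pair_mem_lam.2 ⟨hη, rfl⟩) h1 h2 _ ((hv.2 _).2 rfl)
      refine ⟨α, hα, ?_⟩
      rw [hfe] at hs
      rw [(pair_mem_lam.1 hs).2] at hw
      rw [(pair_mem_lamO.1 hw).2] at hvw
      exact Ordinal.toZFSet_mem_toZFSet_iff.1 hvw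
    · rw [hfe, hge]
      rfl
  · rintro ⟨d, hd, rfl⟩
    refine ⟨_, _, _, _, rfl, hd.lt, hd.subset, hd.card_lt, ?_, ?_, ?_⟩
    · exact lam_mem_funs fun σ hσ => lamO_mem_funs fun j hj =>
        Ordinal.toZFSet_mem_toZFSet_iff.2 (hd.F_lt σ hσ j hj)
    · exact lam_mem_funs fun η hη => Ordinal.toZFSet_mem_toZFSet_iff.2
        (Order.lt_add_one_iff.2 (hd.G_le η hη))
    · intro η hη γ j hγ h1 h2 v hv
      rw [(((val_spec (hπ (hd.subset hη)) (h2.trans hd.lt)).2 v).1 hv)]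
      obtain rfl := Ordinal.toZFSet_injective (pair_mem_lam.1 hγ).2
      obtain ⟨α, hα, hlt⟩ := hd.bound η hη j h1 h2
      exact ⟨α, hα, _, _, pair_mem_lam.2 ⟨restr_mem_tree hη hα, rfl⟩,
        pair_mem_lamO.2 ⟨h2, rfl⟩, Ordinal.toZFSet_mem_toZFSet_iff.2 hlt⟩

theorem qle_toSet {d d' : Cond.{u}} : QLe τ (d.toSet τ) (d'.toSet τ) ↔ d.Le τ d' := by
  constructor
  · rintro ⟨i, U, f, g, i', U', f', g', e, e', h1, h2, h3, h4⟩
    obtain ⟨rfl, rfl, rfl, rfl⟩ := tuple_inj e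
    obtain ⟨rfl, rfl, rfl, rfl⟩ := tuple_inj e'
    refine ⟨h1, h2, fun η hη => Ordinal.toZFSet_injective ((lam_subset_lam h2).1 h3 η hη),
      fun σ hσ j hj => ?_⟩
    have := h4 σ hσ _ _ (pair_mem_lam.2 ⟨hσ, rfl⟩) (pair_mem_lam.2 ⟨tree_mono h2 hσ, rfl⟩)
    exact Ordinal.toZFSet_injective ((lamO_subset_lamO h1).1 this j hj)
  · intro h
    refine ⟨_, _, _, _, _, _, _, _, rfl, rfl, h.i_le, h.U_subset,
      (lam_subset_lam h.U_subset).2 fun η hη => congrArg _ (h.G_eq η hη), ?_⟩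
    intro σ hσ s s' hs hs'
    rw [(pair_mem_lam.1 hs).2, (pair_mem_lam.1 hs').2]
    exact (lamO_subset_lamO h.i_le).2 fun j hj => congrArg _ (h.F_eq σ hσ j hj)

theorem le_def {p q : ZFSet.{u}} : (Q κ τ μ π).le p q ↔
    p ∈ (Q κ τ μ π).carrier ∧ q ∈ (Q κ τ μ π).carrier ∧ QLe τ p q := by
  simp only [RelSet.le, Q, ZFSet.mem_pairSep, ZFSet.pair_inj]
  constructor
  · rintro ⟨a, ha, b, hb, ⟨rfl, rfl⟩, h⟩
    exact ⟨ha, hb, h⟩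
  · rintro ⟨ha, hb, h⟩
    exact ⟨p, ha, q, hb, ⟨rfl, rfl⟩, h⟩

include hπ

theorem toSet_mem {d : Cond.{u}} (hd : d.Valid κ τ μ π) : d.toSet τ ∈ (Q κ τ μ π).carrier :=
  (mem_carrier_iff hπ).2 ⟨d, hd, rfl⟩

theorem toSet_le {d d' : Cond.{u}} (hd : d.Valid κ τ μ π) (hd' : d'.Valid κ τ μ π) :
    (Q κ τ μ π).le (d.toSet τ) (d'.toSet τ) ↔ d.Le τ d' := by
  rw [le_def, qle_toSet]
  exact ⟨fun h => h.2.2, fun h => ⟨toSet_mem hπ hd, toSet_mem hπ hd', h⟩⟩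

theorem le_refl' {p : ZFSet.{u}} (hp : p ∈ (Q κ τ μ π).carrier) : (Q κ τ μ π).le p p := by
  obtain ⟨d, hd, rfl⟩ := (mem_carrier_iff hπ).1 hp
  exact (toSet_le hπ hd hd).2 (.refl τ d)

theorem le_trans' {p q r : ZFSet.{u}} (h : (Q κ τ μ π).le p q) (h' : (Q κ τ μ π).le q r) :
    (Q κ τ μ π).le p r := by
  obtain ⟨a, ha, rfl⟩ := (mem_carrier_iff hπ).1 (le_def.1 h).1
  obtain ⟨b, hb, rfl⟩ := (mem_carrier_iff hπ).1 (le_def.1 h).2.1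
  obtain ⟨c, hc, rfl⟩ := (mem_carrier_iff hπ).1 (le_def.1 h').2.1
  exact (toSet_le hπ ha hc).2 (((toSet_le hπ ha hb).1 h).trans ((toSet_le hπ hb hc).1 h'))

theorem le_antisymm' {p q : ZFSet.{u}} (h : (Q κ τ μ π).le p q) (h' : (Q κ τ μ π).le q p) :
    p = q := by
  obtain ⟨a, ha, rfl⟩ := (mem_carrier_iff hπ).1 (le_def.1 h).1
  obtain ⟨b, hb, rfl⟩ := (mem_carrier_iff hπ).1 (le_def.1 h).2.1
  exact ((toSet_le hπ ha hb).1 h).toSet_eq ((toSet_le hπ hb ha).1 h')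

theorem isForcingNotion_Q (hκ : κ.IsRegular) : (Q κ τ μ π).IsForcingNotion := by
  refine ⟨?_, fun p hp => le_refl' hπ hp, fun p q r h h' => le_trans' hπ h h', ?_⟩
  · intro z hz
    simp only [Q, ZFSet.mem_pairSep] at hz
    obtain ⟨a, ha, b, hb, e, -⟩ := hz
    exact ⟨a, ha, b, hb, e⟩
  · have hv : (⟨0, ∅, fun _ _ => 0, fun _ => 0⟩ : Cond.{u}).Valid κ τ μ π := by
      refine ⟨hκ.ord_pos, ZFSet.empty_subset _, ?_, fun _ _ j hj => absurd hj not_lt_zero,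
        fun η hη => absurd hη (ZFSet.notMem_empty η), fun η hη => absurd hη (ZFSet.notMem_empty η)⟩
      simpa using hκ.pos
    have hw : (Q κ τ μ π).IsWeakest
        ((⟨0, ∅, fun _ _ => 0, fun _ => 0⟩ : Cond.{u}).toSet τ) := by
      refine ⟨toSet_mem hπ hv, fun p hp => ?_⟩
      obtain ⟨d, hd, rfl⟩ := (mem_carrier_iff hπ).1 hp
      refine (toSet_le hπ hv hd).2 ⟨zero_le, ZFSet.empty_subset _, ?_, ?_⟩
      · exact fun η hη => absurd hη (ZFSet.notMem_empty η)
      · exact fun _ _ j hj => absurd hj not_lt_zero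
    exact ⟨_, hw, fun e he => le_antisymm' hπ (he.2 _ hw.1) (hw.2 _ he.1)⟩

end Conditions

/-! ### Unions, extensions and amalgams of conditions -/

/-- The hypotheses on the parameters of the forcing that are used below. -/
structure Params (κ τ : Cardinal.{u}) (μ : Ordinal.{u} → Cardinal.{u})
    (π : ZFSet.{u} → ZFSet.{u}) : Prop where
  reg : κ.IsRegular
  pow : (2 : Cardinal.{u}) ^< κ = κ
  tau_reg : τ.IsRegular
  tau_lt : τ < κ
  le_mu : ∀ α < τ.ord, κ ≤ μ α
  bij : Set.BijOn π {η | η ∈ seqs μ τ.ord} {h | h ∈ ZFSet.funs (cardSet κ) (cardSet κ)}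

theorem mk_coe_lt {κ : Cardinal.{u}} {A : ZFSet.{u}} :
    #A < lift.{u + 1} κ ↔ A.card < κ := by
  rw [ZFSet.cardinalMk_coe_sort, Cardinal.lift_lt]

section

variable {κ τ : Cardinal.{u}} {μ : Ordinal.{u} → Cardinal.{u}} {π : ZFSet.{u} → ZFSet.{u}}

/-- An increasing chain of conditions of length less than `κ` has a least upper bound, which is
its union. -/
theorem exists_union (hκ : κ.IsRegular) {δ : Ordinal.{u}} (hδ : δ < κ.ord)
    {c : Ordinal.{u} → Cond.{u}} (hc : ∀ ξ < δ, (c ξ).Valid κ τ μ π)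
    (hmono : ∀ ξ ζ, ξ ≤ ζ → ζ < δ → (c ξ).Le τ (c ζ)) :
    ∃ D : Cond.{u}, D.Valid κ τ μ π ∧ (∀ ξ < δ, (c ξ).Le τ D) ∧
      (∀ E : Cond.{u}, (∀ ξ < δ, (c ξ).Le τ E) → D.Le τ E) ∧
      (∀ η ∈ D.U, ∃ ξ < δ, η ∈ (c ξ).U) ∧ ∀ j < D.i, ∃ ξ < δ, j < (c ξ).i := by
  classical
  have hδc : #(Set.Iio δ) < lift.{u + 1} κ := by
    rw [Cardinal.mk_Iio_ordinal, Cardinal.lift_lt]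
    exact lt_ord.1 hδ
  let I : Ordinal.{u} := ⨆ ξ : Set.Iio δ, (c ξ).i
  let V : ZFSet.{u} := ZFSet.iUnion fun ξ : Set.Iio δ => (c ξ).U
  have hI : ∀ j, j < I ↔ ∃ ξ < δ, j < (c ξ).i := fun j => by
    simp only [I, Ordinal.lt_iSup_iff, Subtype.exists, Set.mem_Iio, exists_prop]
  have hV : ∀ η, η ∈ V ↔ ∃ ξ < δ, η ∈ (c ξ).U := fun η => by
    simp only [V, ZFSet.mem_iUnion, Subtype.exists, Set.mem_Iio, exists_prop]
  have hT : ∀ σ, σ ∈ tree τ V ↔ ∃ ξ < δ, σ ∈ tree τ (c ξ).U := fun σ => by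
    constructor
    · intro h
      obtain ⟨η, hη, α, hα, rfl⟩ := mem_tree.1 h
      obtain ⟨ξ, hξ, hη⟩ := (hV η).1 hη
      exact ⟨ξ, hξ, restr_mem_tree hη hα⟩
    · rintro ⟨ξ, hξ, h⟩
      exact tree_mono (fun η hη => (hV η).2 ⟨ξ, hξ, hη⟩) h
  -- the values are read off from any member of the chain where they are defined
  have hFex : ∀ σ j, ∃ v : Ordinal.{u}, ∀ ξ < δ, σ ∈ tree τ (c ξ).U → j < (c ξ).i →
      v = (c ξ).F σ j := by
    intro σ j
    by_cases h : ∃ ξ < δ, σ ∈ tree τ (c ξ).U ∧ j < (c ξ).i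
    · obtain ⟨ξ, hξ, h1, h2⟩ := h
      refine ⟨(c ξ).F σ j, fun ζ hζ h3 h4 => ?_⟩
      rcases le_total ξ ζ with hle | hle
      · exact (hmono ξ ζ hle hζ).F_eq σ h1 j h2
      · exact ((hmono ζ ξ hle hξ).F_eq σ h3 j h4).symm
    · exact ⟨0, fun ζ hζ h3 h4 => absurd ⟨ζ, hζ, h3, h4⟩ h⟩
  have hGex : ∀ η, ∃ v : Ordinal.{u}, ∀ ξ < δ, η ∈ (c ξ).U → v = (c ξ).G η := by
    intro η
    by_cases h : ∃ ξ < δ, η ∈ (c ξ).U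
    · obtain ⟨ξ, hξ, h1⟩ := h
      refine ⟨(c ξ).G η, fun ζ hζ h3 => ?_⟩
      rcases le_total ξ ζ with hle | hle
      · exact (hmono ξ ζ hle hζ).G_eq η h1
      · exact ((hmono ζ ξ hle hξ).G_eq η h3).symm
    · exact ⟨0, fun ζ hζ h3 => absurd ⟨ζ, hζ, h3⟩ h⟩
  choose F hF using hFex
  choose G hG using hGex
  -- two members of the chain are included in a third one
  have hmax : ∀ ξ < δ, ∀ ζ < δ, ∃ ρ < δ, (c ξ).Le τ (c ρ) ∧ (c ζ).Le τ (c ρ) := by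
    intro ξ hξ ζ hζ
    rcases le_total ξ ζ with hle | hle
    · exact ⟨ζ, hζ, hmono ξ ζ hle hζ, .refl _ _⟩
    · exact ⟨ξ, hξ, .refl _ _, hmono ζ ξ hle hξ⟩
  have hle : ∀ ξ < δ, (c ξ).Le τ ⟨I, V, F, G⟩ := fun ξ hξ =>
    ⟨le_of_forall_lt fun j hj => (hI j).2 ⟨ξ, hξ, hj⟩, fun η hη => (hV η).2 ⟨ξ, hξ, hη⟩,
      fun η hη => (hG η ξ hξ hη).symm, fun σ hσ j hj => (hF σ j ξ hξ hσ hj).symm⟩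
  have hlub : ∀ E : Cond.{u}, (∀ ξ < δ, (c ξ).Le τ E) → Cond.Le τ ⟨I, V, F, G⟩ E := by
    intro E hE
    refine ⟨le_of_forall_lt fun j hj => ?_, fun η hη => ?_, fun η hη => ?_, fun σ hσ j hj => ?_⟩
    · obtain ⟨ξ, hξ, h⟩ := (hI j).1 hj
      exact h.trans_le (hE ξ hξ).i_le
    · obtain ⟨ξ, hξ, h⟩ := (hV η).1 hη
      exact (hE ξ hξ).U_subset h
    · obtain ⟨ξ, hξ, h⟩ := (hV η).1 hη
      exact (hG η ξ hξ h).trans ((hE ξ hξ).G_eq η h)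
    · obtain ⟨ξ, hξ, h⟩ := (hT σ).1 hσ
      obtain ⟨ζ, hζ, h'⟩ := (hI j).1 hj
      obtain ⟨ρ, hρ, h1, h2⟩ := hmax ξ hξ ζ hζ
      have h3 := tree_mono h1.U_subset h
      have h4 := h'.trans_le h2.i_le
      exact (hF σ j ρ hρ h3 h4).trans ((hE ρ hρ).F_eq σ h3 j h4)
  refine ⟨⟨I, V, F, G⟩, ⟨?_, ?_, ?_, ?_, ?_, ?_⟩, hle, hlub, fun η hη => (hV η).1 hη,
    fun j hj => (hI j).1 hj⟩
  · obtain ⟨b, hb, hb'⟩ := exists_lt_of_card_lt hκ hδc (fun ξ => (c ξ).i)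
      (fun ξ => (hc ξ ξ.2).lt)
    exact (ciSup_le' hb').trans_lt hb
  · intro η hη
    obtain ⟨ξ, hξ, h⟩ := (hV η).1 hη
    exact (hc ξ hξ).subset h
  · rw [← mk_coe_lt]
    have h1 : (V : Set ZFSet.{u}) = ⋃ ξ : Set.Iio δ, ((c ξ).U : Set ZFSet.{u}) :=
      ZFSet.coe_iUnion _
    have h2 := (card_iUnion_lt_iff_forall_of_isRegular (t := fun ξ : Set.Iio δ =>
      ((c ξ).U : Set ZFSet.{u})) hκ.lift hδc).2 fun ξ => mk_coe_lt.2 (hc ξ ξ.2).card_lt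
    rw [← h1] at h2
    exact h2
  · intro σ hσ j hj
    obtain ⟨ξ, hξ, h⟩ := (hT σ).1 hσ
    obtain ⟨ζ, hζ, h'⟩ := (hI j).1 hj
    obtain ⟨ρ, hρ, h1, h2⟩ := hmax ξ hξ ζ hζ
    have h3 := tree_mono h1.U_subset h
    have h4 := h'.trans_le h2.i_le
    refine (hF σ j ρ hρ h3 h4).trans_lt ?_
    exact (hc ρ hρ).F_lt σ h3 j h4
  · intro η hη
    obtain ⟨ξ, hξ, h⟩ := (hV η).1 hη
    refine (hG η ξ hξ h).trans_le ?_
    exact ((hc ξ hξ).G_le η h).trans (hle ξ hξ).i_le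
  · intro η hη j h1 h2
    obtain ⟨ξ, hξ, h⟩ := (hV η).1 hη
    obtain ⟨ζ, hζ, h'⟩ := (hI j).1 h2
    obtain ⟨ρ, hρ, h3, h4⟩ := hmax ξ hξ ζ hζ
    have h5 := h3.U_subset h
    have h6 := h'.trans_le h4.i_le
    replace h1 : (c ρ).G η ≤ j := (hG η ρ hρ h5).ge.trans h1
    obtain ⟨α, hα, hlt⟩ := (hc ρ hρ).bound η h5 j h1 h6
    exact ⟨α, hα, hlt.trans_eq (hF _ j ρ hρ (restr_mem_tree h5 hα) h6).symm⟩

theorem Params.mapsTo (P : Params κ τ μ π) :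
    Set.MapsTo π {η | η ∈ seqs μ τ.ord} {h | h ∈ ZFSet.funs (cardSet κ) (cardSet κ)} :=
  P.bij.mapsTo

/-- Less than `κ` many of the functions `π_η` are dominated everywhere by one function `b`. -/
theorem exists_large (P : Params κ τ μ π) {U : ZFSet.{u}} (hU : U ⊆ seqs μ τ.ord)
    (hUc : U.card < κ) :
    ∃ b : Ordinal.{u} → Ordinal.{u}, ∀ j < κ.ord, b j < κ.ord ∧
      ∀ η ∈ U, val (π η) j < b j := by
  have h : ∀ j, ∃ b, j < κ.ord → b < κ.ord ∧ ∀ η ∈ U, val (π η) j < b := by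
    intro j
    by_cases hj : j < κ.ord
    · obtain ⟨b, hb, hb'⟩ := exists_lt_of_card_lt P.reg (mk_coe_lt.2 hUc)
        (fun η => val (π η) j) (fun η => (val_spec (P.mapsTo (hU η.2)) hj).1)
      exact ⟨Order.succ b, fun _ => ⟨(isSuccLimit_ord P.reg.aleph0_le).succ_lt hb,
        fun η hη => Order.lt_succ_of_le (hb' ⟨η, hη⟩)⟩⟩
    · exact ⟨0, fun h => absurd h hj⟩
  choose b hb using h
  exact ⟨b, hb⟩

theorem card_union_lt (hκ : κ.IsRegular) {A B : ZFSet.{u}} (hA : A.card < κ) (hB : B.card < κ) :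
    (A ∪ B).card < κ :=
  ZFSet.card_union_le.trans_lt (add_lt_of_lt hκ.aleph0_le hA hB)

/-- A condition can be extended by less than `κ` many branches, with arbitrary values at the new
nodes below its height, and to any larger height. -/
theorem exists_extension (P : Params κ τ μ π) {d : Cond.{u}} (hd : d.Valid κ τ μ π)
    {V : ZFSet.{u}} (hV : V ⊆ seqs μ τ.ord) (hVc : V.card < κ) {i : Ordinal.{u}}
    (hi : d.i ≤ i) (hiκ : i < κ.ord) (F₀ : ZFSet.{u} → Ordinal.{u} → Ordinal.{u})
    (hF₀ : ∀ σ, ∀ j < d.i, F₀ σ j < κ.ord) :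
    ∃ e : Cond.{u}, e.Valid κ τ μ π ∧ d.Le τ e ∧ e.i = i ∧ e.U = d.U ∪ V ∧
      ∀ σ, σ ∉ tree τ d.U → ∀ j < d.i, e.F σ j = F₀ σ j := by
  classical
  have hUV : d.U ∪ V ⊆ seqs μ τ.ord := fun η hη =>
    (ZFSet.mem_union.1 hη).elim (fun h => hd.subset h) (fun h => hV h)
  have hUVc := card_union_lt P.reg hd.card_lt hVc
  obtain ⟨b, hb⟩ := exists_large P hUV hUVc
  -- with `d.i` as the value of `G` at new branches, nothing is required of them below `d.i`
  refine ⟨⟨i, d.U ∪ V, fun σ j => if j < d.i then if σ ∈ tree τ d.U then d.F σ j else F₀ σ j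
    else b j, fun η => if η ∈ d.U then d.G η else d.i⟩, ⟨hiκ, hUV, hUVc, ?_, ?_, ?_⟩,
    ⟨hi, fun η hη => ZFSet.mem_union.2 (Or.inl hη), fun η hη => (if_pos hη).symm, ?_⟩, rfl, rfl, ?_⟩
  · intro σ hσ j hj
    dsimp only
    split_ifs with h1 h2
    · exact hd.F_lt σ h2 j h1
    · exact hF₀ σ j h1
    · exact (hb j (hj.trans hiκ)).1
  · intro η hη
    dsimp only
    split_ifs with h1
    · exact (hd.G_le η h1).trans hi
    · exact hi
  · intro η hη j h1 h2
    dsimp only at h1 h2 ⊢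
    by_cases h3 : j < d.i
    · by_cases h4 : η ∈ d.U
      · rw [if_pos h4] at h1
        obtain ⟨α, hα, hlt⟩ := hd.bound η h4 j h1 h3
        refine ⟨α, hα, ?_⟩
        rwa [if_pos h3, if_pos (restr_mem_tree h4 hα)]
      · rw [if_neg h4] at h1
        exact absurd h3 h1.not_gt
    · refine ⟨0, P.tau_reg.ord_pos, ?_⟩
      rw [if_neg h3]
      exact (hb j (h2.trans hiκ)).2 η hη
  · intro σ hσ j hj
    dsimp only
    rw [if_pos hj, if_pos hσ]
  · intro σ hσ j hj
    dsimp only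
    rw [if_pos hj, if_neg hσ]

/-- Two conditions that agree on their common domain are compatible, provided that every branch
of the lower one that is missing in the higher one has a node missing in the higher one: between
the two heights the requirement on such a branch is met at that node. -/
theorem exists_amalgam (P : Params κ τ μ π) {d d' : Cond.{u}} (hd : d.Valid κ τ μ π)
    (hd' : d'.Valid κ τ μ π) (hi : d.i ≤ d'.i)
    (hF : ∀ σ ∈ tree τ d.U, σ ∈ tree τ d'.U → ∀ j < d.i, d.F σ j = d'.F σ j)
    (hG : ∀ η ∈ d.U, η ∈ d'.U → d.G η = d'.G η)
    (hfree : ∀ η ∈ d.U, η ∉ d'.U → d.i < d'.i → ∃ α < τ.ord, restr η α ∉ tree τ d'.U) :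
    ∃ e : Cond.{u}, e.Valid κ τ μ π ∧ d.Le τ e ∧ d'.Le τ e := by
  classical
  obtain ⟨b, hb⟩ := exists_large P hd.subset hd.card_lt
  -- outside the nodes of `d'`, the values above `d.i` are large enough for all branches of `d`
  refine ⟨⟨d'.i, d.U ∪ d'.U, fun σ j => if σ ∈ tree τ d'.U then d'.F σ j else
    if j < d.i then d.F σ j else b j, fun η => if η ∈ d'.U then d'.G η else d.G η⟩,
    ⟨hd'.lt, ?_, card_union_lt P.reg hd.card_lt hd'.card_lt, ?_, ?_, ?_⟩,
    ⟨hi, fun η hη => ZFSet.mem_union.2 (Or.inl hη), ?_, ?_⟩,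
    ⟨le_rfl, fun η hη => ZFSet.mem_union.2 (Or.inr hη), fun η hη => (if_pos hη).symm,
      fun σ hσ j hj => (if_pos hσ).symm⟩⟩
  · exact fun η hη => (ZFSet.mem_union.1 hη).elim (fun h => hd.subset h) (fun h => hd'.subset h)
  · intro σ hσ j hj
    dsimp only
    split_ifs with h1 h2
    · exact hd'.F_lt σ h1 j hj
    · exact hd.F_lt σ ((mem_tree_union.1 hσ).resolve_right h1) j h2
    · exact (hb j (hj.trans hd'.lt)).1
  · intro η hη
    dsimp only
    split_ifs with h1
    · exact hd'.G_le η h1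
    · exact (hd.G_le η ((ZFSet.mem_union.1 hη).resolve_right h1)).trans hi
  · intro η hη j h1 h2
    dsimp only at h1 h2 ⊢
    by_cases h3 : η ∈ d'.U
    · rw [if_pos h3] at h1
      obtain ⟨α, hα, hlt⟩ := hd'.bound η h3 j h1 h2
      exact ⟨α, hα, by rwa [if_pos (restr_mem_tree h3 hα)]⟩
    · rw [if_neg h3] at h1
      have h4 := (ZFSet.mem_union.1 hη).resolve_right h3
      by_cases h5 : j < d.i
      · obtain ⟨α, hα, hlt⟩ := hd.bound η h4 j h1 h5
        refine ⟨α, hα, ?_⟩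
        have h6 := restr_mem_tree (τ := τ) h4 hα
        split_ifs with h7
        · rwa [← hF _ h6 h7 j h5]
        · exact hlt
      · obtain ⟨α, hα, h6⟩ := hfree η h4 h3 ((not_lt.1 h5).trans_lt h2)
        refine ⟨α, hα, ?_⟩
        rw [if_neg h6, if_neg h5]
        exact (hb j (h2.trans hd'.lt)).2 η h4
  · intro η hη
    dsimp only
    split_ifs with h1
    · exact hG η hη h1
    · rfl
  · intro σ hσ j hj
    dsimp only
    split_ifs with h1
    · exact hF σ hσ h1 j hj
    · rfl

/-- The least upper bounds of chains of conditions, with their description as unions. -/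
theorem exists_isLeastUpperBound (P : Params κ τ μ π) {δ : Ordinal.{u}} (hδ : δ < κ.ord)
    {s : Ordinal.{u} → ZFSet.{u}} (hs : (Q κ τ μ π).IsChainOn δ s) :
    ∃ (c : Ordinal.{u} → Cond.{u}) (D : Cond.{u}),
      (∀ ξ < δ, (c ξ).Valid κ τ μ π ∧ s ξ = (c ξ).toSet τ ∧ (c ξ).Le τ D) ∧
      (∀ ξ ζ, ξ ≤ ζ → ζ < δ → (c ξ).Le τ (c ζ)) ∧
      D.Valid κ τ μ π ∧ (Q κ τ μ π).IsLeastUpperBound (s '' Set.Iio δ) (D.toSet τ) ∧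
      (∀ η ∈ D.U, ∃ ξ < δ, η ∈ (c ξ).U) ∧ ∀ j < D.i, ∃ ξ < δ, j < (c ξ).i := by
  have hex : ∀ ξ, ∃ d : Cond.{u}, ξ < δ → d.Valid κ τ μ π ∧ s ξ = d.toSet τ := by
    intro ξ
    by_cases hξ : ξ < δ
    · obtain ⟨d, hd⟩ := (mem_carrier_iff P.mapsTo).1 (hs.1 ξ hξ)
      exact ⟨d, fun _ => hd⟩
    · exact ⟨⟨0, ∅, fun _ _ => 0, fun _ => 0⟩, fun h => absurd h hξ⟩
  choose c hc using hex
  have hmono : ∀ ξ ζ, ξ ≤ ζ → ζ < δ → (c ξ).Le τ (c ζ) := by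
    intro ξ ζ h1 h2
    have h3 := hc ξ (h1.trans_lt h2)
    have h4 := hc ζ h2
    rw [← toSet_le P.mapsTo h3.1 h4.1, ← h3.2, ← h4.2]
    exact hs.2 ξ ζ h1 h2
  obtain ⟨D, hD, h1, h2, h3, h4⟩ := exists_union P.reg hδ (fun ξ hξ => (hc ξ hξ).1) hmono
  refine ⟨c, D, fun ξ hξ => ⟨(hc ξ hξ).1, (hc ξ hξ).2, h1 ξ hξ⟩, hmono, hD, ⟨⟨?_, ?_⟩, ?_⟩, h3, h4⟩
  · exact toSet_mem P.mapsTo hD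
  · rintro _ ⟨ξ, hξ, rfl⟩
    rw [(hc ξ hξ).2]
    exact (toSet_le P.mapsTo (hc ξ hξ).1 hD).2 (h1 ξ hξ)
  · rintro _ ⟨hb, hb'⟩
    obtain ⟨E, hE, rfl⟩ := (mem_carrier_iff P.mapsTo).1 hb
    refine (toSet_le P.mapsTo hD hE).2 (h2 E fun ξ hξ => ?_)
    rw [← toSet_le P.mapsTo (hc ξ hξ).1 hE, ← (hc ξ hξ).2]
    exact hb' _ ⟨ξ, hξ, rfl⟩

theorem lubComplete_Q (P : Params κ τ μ π) : (Q κ τ μ π).LubComplete κ := by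
  intro δ hδ s hs
  obtain ⟨c, D, -, -, -, h, -⟩ := exists_isLeastUpperBound P hδ hs
  exact ⟨_, h⟩

/-! ### The dominating family -/

theorem toSet_mem_valueSet (P : Params κ τ μ π) {d : Cond.{u}} (hd : d.Valid κ τ μ π)
    {σ w : ZFSet.{u}} {j : Ordinal.{u}} :
    d.toSet τ ∈ valueSet (Q κ τ μ π) σ j w ↔
      σ ∈ tree τ d.U ∧ j < d.i ∧ w = (d.F σ j).toZFSet := by
  constructor
  · rintro ⟨-, i, U, f, g, s, e, h1, h2⟩
    obtain ⟨rfl, rfl, rfl, rfl⟩ := tuple_inj e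
    obtain ⟨h3, rfl⟩ := pair_mem_lam.1 h1
    exact ⟨h3, pair_mem_lamO.1 h2⟩
  · rintro ⟨h1, h2, rfl⟩
    exact ⟨toSet_mem P.mapsTo hd, _, _, _, _, _, rfl, pair_mem_lam.2 ⟨h1, rfl⟩,
      pair_mem_lamO.2 ⟨h2, rfl⟩⟩

theorem forcedFunction_Q (P : Params κ τ μ π) {α : Ordinal.{u}} (hα : α < τ.ord) {σ : ZFSet.{u}}
    (hσ : σ ∈ seqs μ α) : ForcedFunction (Q κ τ μ π) κ σ := by
  intro j hj
  have hπ := P.mapsTo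
  constructor
  · intro p hp q hpq
    obtain ⟨d, hd, rfl⟩ := (mem_carrier_iff hπ).1 (le_def.1 hpq).2.1
    obtain ⟨η, hη, rfl⟩ := exists_branch hα.le
      (fun β hβ => (P.reg.pos.trans_le (P.le_mu β hβ)).ne') hσ
    have hlim := isSuccLimit_ord P.reg.aleph0_le
    obtain ⟨e, he, hle, hei, heU, -⟩ := exists_extension P hd (V := {η})
      (fun x hx => ZFSet.mem_singleton.1 hx ▸ hη)
      (by rw [ZFSet.card_singleton]; exact one_lt_aleph0.trans_le P.reg.aleph0_le)
      (le_max_left d.i (Order.succ j)) (max_lt hd.lt (hlim.succ_lt hj)) (fun _ _ => 0)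
      (fun _ _ _ => P.reg.ord_pos)
    have hmem : restr η α ∈ tree τ e.U := restr_mem_tree
      (by rw [heU]; exact ZFSet.mem_union.2 (Or.inr (ZFSet.mem_singleton.2 rfl))) hα
    have hj' : j < e.i := by
      rw [hei]
      exact (Order.lt_succ j).trans_le (le_max_right _ _)
    refine ⟨e.toSet τ, (toSet_le hπ hd he).2 hle, e.toSet τ, ⟨(e.F (restr η α) j).toZFSet, ?_, ?_⟩,
      le_refl' hπ (toSet_mem hπ he)⟩
    · exact Ordinal.toZFSet_mem_toZFSet_iff.2 (he.F_lt _ hmem j hj')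
    · exact (toSet_mem_valueSet P he).2 ⟨hmem, hj', rfl⟩
  · rintro w w' hne p hp ⟨h1, h2⟩
    obtain ⟨r, hr, a, ha, har⟩ := h1 p (le_refl' hπ hp)
    obtain ⟨r', hr', a', ha', har'⟩ := h2 r hr
    have har2 := le_trans' hπ har hr'
    obtain ⟨x, hx, rfl⟩ := (mem_carrier_iff hπ).1 ha.1
    obtain ⟨y, hy, rfl⟩ := (mem_carrier_iff hπ).1 ha'.1
    obtain ⟨z, hz, rfl⟩ := (mem_carrier_iff hπ).1 (le_def.1 har').2.1
    obtain ⟨h3, h4, rfl⟩ := (toSet_mem_valueSet P hx).1 ha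
    obtain ⟨h5, h6, rfl⟩ := (toSet_mem_valueSet P hy).1 ha'
    have e1 := ((toSet_le hπ hx hz).1 har2).F_eq σ h3 j h4
    have e2 := ((toSet_le hπ hy hz).1 har').F_eq σ h5 j h6
    exact hne (by rw [e1, e2])

/-- Some branch leaves the nodes of less than `κ` many given branches at its first step, as there
are `μ 0 ≥ κ` many first values. -/
theorem exists_fresh (P : Params κ τ μ π) {U : ZFSet.{u}} (hU : U ⊆ seqs μ τ.ord)
    (hUc : U.card < κ) : ∃ η ∈ seqs μ τ.ord, restr η 1 ∉ tree τ U := by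
  classical
  by_contra! hcon
  have hpos : ∀ β < τ.ord, (0 : Ordinal.{u}) < (μ β).ord := fun β hβ =>
    (P.reg.ord_pos).trans_le (ord_le_ord.2 (P.le_mu β hβ))
  have h1τ : 1 < τ.ord := by
    have := (isSuccLimit_ord P.tau_reg.aleph0_le).succ_lt P.tau_reg.ord_pos
    simpa using this
  -- `b v` is the branch `(v, 0, 0, …)`; distinct `v` would give distinct members of `U`
  let b : Ordinal.{u} → ZFSet.{u} := fun v =>
    lamO τ.ord fun j => if j = 0 then v.toZFSet else Ordinal.toZFSet 0
  have hb : ∀ v < (μ 0).ord, b v ∈ seqs μ τ.ord := by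
    intro v hv
    refine mem_seqs.2 ⟨_, fun β hβ => ?_, rfl⟩
    split_ifs with h
    · subst h
      exact Ordinal.toZFSet_mem_toZFSet_iff.2 hv
    · exact Ordinal.toZFSet_mem_toZFSet_iff.2 (hpos β hβ)
  have hex : ∀ v : Set.Iio (μ 0).ord, ∃ η : U,
      ZFSet.pair (Ordinal.toZFSet 0) v.1.toZFSet ∈ η.1 := by
    intro v
    obtain ⟨η, hη, α, hα, e⟩ := mem_tree.1 (hcon (b v) (hb v v.2))
    refine ⟨⟨η, hη⟩, (mem_restr.1 (?_ : _ ∈ restr η α)).1⟩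
    rw [← e]
    exact mem_restr.2 ⟨pair_mem_lamO.2 ⟨P.tau_reg.ord_pos, (if_pos rfl).symm⟩, 0, zero_lt_one,
      _, rfl⟩
  choose f hf using hex
  have hinj : Function.Injective f := by
    intro v w hvw
    have h1 := hf v
    have h2 := hf w
    rw [← hvw] at h2
    obtain ⟨k, -, e⟩ := mem_seqs.1 (hU (f v).2)
    rw [e] at h1 h2
    exact Subtype.ext (Ordinal.toZFSet_injective
      ((pair_mem_lamO.1 h1).2.trans (pair_mem_lamO.1 h2).2.symm))
  have h1 := mk_le_of_injective hinj
  rw [mk_Iio_ord] at h1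
  have h2 := h1.trans_lt (mk_coe_lt.2 hUc)
  exact (Cardinal.lift_lt.1 h2).not_ge (P.le_mu 0 P.tau_reg.ord_pos)

theorem card_tree_singleton_le (η : ZFSet.{u}) : (tree τ {η}).card ≤ τ := by
  rw [← Cardinal.lift_le.{u + 1}, ← ZFSet.cardinalMk_coe_sort, ← mk_Iio_ord]
  have hex : ∀ σ : tree τ {η}, ∃ α : Set.Iio τ.ord, σ.1 = restr η α := by
    rintro ⟨σ, hσ⟩
    obtain ⟨η', hη', α, hα, e⟩ := mem_tree.1 hσ
    rw [ZFSet.mem_singleton.1 hη'] at e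
    exact ⟨⟨α, hα⟩, e⟩
  choose f hf using hex
  refine mk_le_of_injective (f := f) fun x y h => Subtype.ext ?_
  rw [hf x, hf y, h]

/-- Given `h = π_η`, put `η` into a condition `p`, which takes care of all `j` above the height of
`p`, and code `h` below that height by the value at a fresh node. -/
theorem addsDominatingFamily_Q (P : Params κ τ μ π) :
    AddsDominatingFamily (Q κ τ μ π) κ τ μ := by
  classical
  have hπ := P.mapsTo
  refine ⟨fun α hα σ hσ => forcedFunction_Q P hα hσ, fun h hh p hp => ?_⟩
  obtain ⟨d, hd, rfl⟩ := (mem_carrier_iff hπ).1 hp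
  obtain ⟨η, hη, rfl⟩ := P.bij.surjOn hh
  have h1κ : (1 : Cardinal.{u}) < κ := one_lt_aleph0.trans_le P.reg.aleph0_le
  have hlim := isSuccLimit_ord P.reg.aleph0_le
  have h1τ : 1 < τ.ord := by
    have := (isSuccLimit_ord P.tau_reg.aleph0_le).succ_lt P.tau_reg.ord_pos
    simpa using this
  obtain ⟨d₁, hd₁, hle₁, hi₁, hU₁, -⟩ := exists_extension P hd (V := {η})
    (fun x hx => ZFSet.mem_singleton.1 hx ▸ hη) (by rwa [ZFSet.card_singleton])
    le_rfl hd.lt (fun _ _ => 0) (fun _ _ _ => P.reg.ord_pos)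
  -- the node `ν ↾ 1` is new, so that its values below the height can be prescribed
  obtain ⟨ν, hν, hfresh⟩ := exists_fresh P hd₁.subset hd₁.card_lt
  obtain ⟨d₂, hd₂, hle₂, hi₂, hU₂, hF₂⟩ := exists_extension P hd₁ (V := {ν})
    (fun x hx => ZFSet.mem_singleton.1 hx ▸ hν) (by rwa [ZFSet.card_singleton])
    le_rfl hd₁.lt (fun _ j => Order.succ (val (π η) j))
    (fun _ j hj => hlim.succ_lt (val_spec hh (hj.trans hd₁.lt)).1)
  have hη₁ : η ∈ d₁.U := by
    rw [hU₁]
    exact ZFSet.mem_union.2 (Or.inr (ZFSet.mem_singleton.2 rfl))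
  have hν₂ : ν ∈ d₂.U := by
    rw [hU₂]
    exact ZFSet.mem_union.2 (Or.inr (ZFSet.mem_singleton.2 rfl))
  refine ⟨d₂.toSet τ, (toSet_le hπ hd hd₂).2 (hle₁.trans hle₂),
    insert (restr ν 1) (tree τ {η}), ?_, ?_, ?_⟩
  · intro σ hσ
    rcases ZFSet.mem_insert_iff.1 hσ with rfl | hσ
    · exact ⟨1, h1τ, restr_mem_seqs hν h1τ.le⟩
    · obtain ⟨η', hη', α, hα, rfl⟩ := mem_tree.1 hσ
      rw [ZFSet.mem_singleton.1 hη']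
      exact ⟨α, hα, restr_mem_seqs hη hα.le⟩
  · refine ZFSet.card_insert_le.trans ?_
    exact add_le_of_le P.tau_reg.aleph0_le (card_tree_singleton_le η)
      (one_le_aleph0.trans P.tau_reg.aleph0_le)
  · intro j hj q hq
    obtain ⟨e, he, rfl⟩ := (mem_carrier_iff hπ).1 (le_def.1 hq).2.1
    obtain ⟨e', he', hle', hei, -, -⟩ := exists_extension P he (V := ∅)
      (ZFSet.empty_subset _) (by rw [ZFSet.card_empty]; exact P.reg.pos)
      (le_max_left e.i (Order.succ j)) (max_lt he.lt (hlim.succ_lt hj)) (fun _ _ => 0)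
      (fun _ _ _ => P.reg.ord_pos)
    have hj' : j < e'.i := by
      rw [hei]
      exact (Order.lt_succ j).trans_le (le_max_right _ _)
    have h2e := ((toSet_le hπ hd₂ he).1 hq).trans hle'
    have hv := (val_spec hh hj)
    refine ⟨e'.toSet τ, (toSet_le hπ he he').2 hle', e'.toSet τ, ?_,
      le_refl' hπ (toSet_mem hπ he')⟩
    by_cases hjd : j < d₁.i
    · have hm : restr ν 1 ∈ tree τ d₂.U := restr_mem_tree hν₂ h1τ
      refine ⟨restr ν 1, ZFSet.mem_insert _ _, _, (val (π η) j).toZFSet,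
        (toSet_mem_valueSet P he').2 ⟨tree_mono h2e.U_subset hm, hj', rfl⟩, (hv.2 _).2 rfl, ?_⟩
      rw [← h2e.F_eq _ hm j (by rwa [hi₂]), hF₂ _ hfresh j hjd]
      exact Ordinal.toZFSet_mem_toZFSet_iff.2 (Order.lt_succ _)
    · have hle := hle₂.trans h2e
      have hηe : η ∈ e'.U := hle.U_subset hη₁
      have hG : e'.G η ≤ j := by
        rw [← hle.G_eq η hη₁]
        exact (hd₁.G_le η hη₁).trans (not_lt.1 hjd)
      obtain ⟨α, hα, hlt⟩ := he'.bound η hηe j hG hj'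
      exact ⟨restr η α, ZFSet.mem_insert_of_mem _
        (restr_mem_tree (ZFSet.mem_singleton.2 rfl) hα), _, (val (π η) j).toZFSet,
        (toSet_mem_valueSet P he').2 ⟨restr_mem_tree hηe hα, hj', rfl⟩, (hv.2 _).2 rfl,
        Ordinal.toZFSet_mem_toZFSet_iff.2 hlt⟩

end

/-! ### The chain condition -/

section

variable {κ τ : Cardinal.{u}} {μ : Ordinal.{u} → Cardinal.{u}} {π : ZFSet.{u} → ZFSet.{u}}

/-- All the information in a condition besides its set of branches: a set of less than `κ` many
pairs `(key, value)`, where the keys stand for the height, the branches and the nodes. -/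
def Cond.graph (τ : Cardinal.{u}) (d : Cond.{u}) :
    Set ((ℕ × ZFSet.{u}) × (Ordinal.{u} × Ordinal.{u})) :=
  ({((0, ∅), (0, d.i))} ∪ (fun η => ((1, η), (0, d.G η))) '' {η | η ∈ d.U}) ∪
    (fun z : ZFSet.{u} × Ordinal.{u} => ((2, z.1), (z.2, d.F z.1 z.2))) ''
      ({σ | σ ∈ tree τ d.U} ×ˢ Set.Iio d.i)

theorem Cond.height_mem_graph {d : Cond.{u}} {x : ZFSet.{u}} {y : Ordinal.{u} × Ordinal.{u}} :
    ((0, x), y) ∈ d.graph τ ↔ x = ∅ ∧ y = (0, d.i) := by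
  simp [Cond.graph]

theorem Cond.branch_mem_graph {d : Cond.{u}} {η : ZFSet.{u}} {y : Ordinal.{u} × Ordinal.{u}} :
    ((1, η), y) ∈ d.graph τ ↔ η ∈ d.U ∧ y = (0, d.G η) := by
  simp [Cond.graph, eq_comm]

theorem Cond.node_mem_graph {d : Cond.{u}} {σ : ZFSet.{u}} {j v : Ordinal.{u}} :
    ((2, σ), (j, v)) ∈ d.graph τ ↔ σ ∈ tree τ d.U ∧ j < d.i ∧ v = d.F σ j := by
  simp only [Cond.graph, Set.mem_union, Set.mem_singleton_iff, Set.mem_image, Set.mem_prod,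
    Prod.mk.injEq, Prod.exists, Set.mem_ofPred_eq, Set.mem_Iio]
  constructor
  · rintro ((⟨⟨h, -⟩, -⟩ | ⟨η, -, ⟨h, -⟩, -⟩) | ⟨a, b, ⟨h1, h2⟩, ⟨-, rfl⟩, rfl, rfl⟩)
    · exact absurd h (by norm_num)
    · exact absurd h (by norm_num)
    · exact ⟨h1, h2, rfl⟩
  · rintro ⟨h1, h2, rfl⟩
    exact Or.inr ⟨σ, j, ⟨h1, h2⟩, ⟨trivial, rfl⟩, rfl, rfl⟩

theorem mk_tree_lt (hκ : κ.IsRegular) (hτ : τ < κ) {U : ZFSet.{u}} (hU : U.card < κ) :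
    #{σ | σ ∈ tree τ U} < lift.{u + 1} κ := by
  have h0 : ℵ₀ ≤ lift.{u + 1} κ := aleph0_le_lift.2 hκ.aleph0_le
  have h1 : {σ | σ ∈ tree τ U} ⊆ Set.range
      (fun z : U × Set.Iio τ.ord => restr z.1 z.2) := by
    intro σ hσ
    obtain ⟨η, hη, α, hα, rfl⟩ := mem_tree.1 hσ
    exact ⟨(⟨η, hη⟩, ⟨α, hα⟩), rfl⟩
  refine (mk_le_mk_of_subset h1).trans_lt (mk_range_le.trans_lt ?_)
  rw [mk_prod, Cardinal.lift_id, Cardinal.lift_id, mk_Iio_ord]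
  exact mul_lt_of_lt h0 (mk_coe_lt.2 hU) (Cardinal.lift_lt.2 hτ)

theorem Cond.mk_graph_lt (P : Params κ τ μ π) {d : Cond.{u}} (hd : d.Valid κ τ μ π) :
    #(d.graph τ) < lift.{u + 1} κ := by
  have h0 : ℵ₀ ≤ lift.{u + 1} κ := aleph0_le_lift.2 P.reg.aleph0_le
  refine (mk_union_le _ _).trans_lt (add_lt_of_lt h0 ((mk_union_le _ _).trans_lt
    (add_lt_of_lt h0 ?_ (mk_image_le.trans_lt ?_))) (mk_image_le.trans_lt ?_))
  · rw [mk_singleton]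
    exact one_lt_aleph0.trans_le h0
  · exact mk_coe_lt.2 hd.card_lt
  · rw [mk_congr (Equiv.Set.prod _ _), mk_prod, Cardinal.lift_id, Cardinal.lift_id]
    refine mul_lt_of_lt h0 (mk_tree_lt P.reg P.tau_lt hd.card_lt) ?_
    rw [Cardinal.mk_Iio_ordinal, Cardinal.lift_lt]
    exact lt_ord.1 hd.lt

theorem mk_prod_Iio_le (hκ : ℵ₀ ≤ κ) :
    #(Set.Iio κ.ord ×ˢ Set.Iio κ.ord : Set (Ordinal.{u} × Ordinal.{u})) ≤ lift.{u + 1} κ := by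
  rw [mk_congr (Equiv.Set.prod _ _), mk_prod, Cardinal.lift_id, mk_Iio_ord,
    mul_eq_self (aleph0_le_lift.2 hκ)]

theorem Cond.snd_mem_of_mem_graph (P : Params κ τ μ π) {d : Cond.{u}} (hd : d.Valid κ τ μ π)
    {z : (ℕ × ZFSet.{u}) × (Ordinal.{u} × Ordinal.{u})} (hz : z ∈ d.graph τ) :
    z.2 ∈ Set.Iio κ.ord ×ˢ Set.Iio κ.ord := by
  rcases hz with (rfl | ⟨η, hη, rfl⟩) | ⟨⟨σ, j⟩, ⟨hσ, hj⟩, rfl⟩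
  · exact ⟨P.reg.ord_pos, hd.lt⟩
  · exact ⟨P.reg.ord_pos, (hd.G_le η hη).trans_lt hd.lt⟩
  · exact ⟨lt_trans hj hd.lt, hd.F_lt σ hσ j hj⟩

/-- Two conditions have the same height and agree where both are defined. -/
structure Cond.Agree (τ : Cardinal.{u}) (d d' : Cond.{u}) : Prop where
  i_eq : d.i = d'.i
  F_eq : ∀ σ ∈ tree τ d.U, σ ∈ tree τ d'.U → ∀ j < d.i, d.F σ j = d'.F σ j
  G_eq : ∀ η ∈ d.U, η ∈ d'.U → d.G η = d'.G η

theorem Cond.agree_of_graph {d d' : Cond.{u}}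
    (h : ∀ x y y', (x, y) ∈ d.graph τ → (x, y') ∈ d'.graph τ → (x, y) ∈ d'.graph τ) :
    d.Agree τ d' := by
  have hi : d.i = d'.i := by
    have := h (0, ∅) (0, d.i) (0, d'.i) (height_mem_graph.2 ⟨rfl, rfl⟩)
      (height_mem_graph.2 ⟨rfl, rfl⟩)
    exact congrArg Prod.snd (height_mem_graph.1 this).2
  refine ⟨hi, fun σ h1 h2 j hj => ?_, fun η h1 h2 => ?_⟩
  · have := h (2, σ) (j, d.F σ j) (j, d'.F σ j) (node_mem_graph.2 ⟨h1, hj, rfl⟩)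
      (node_mem_graph.2 ⟨h2, hi ▸ hj, rfl⟩)
    exact (node_mem_graph.1 this).2.2
  · have := h (1, η) (0, d.G η) (0, d'.G η) (branch_mem_graph.2 ⟨h1, rfl⟩)
      (branch_mem_graph.2 ⟨h2, rfl⟩)
    exact congrArg Prod.snd (branch_mem_graph.1 this).2

/-- The regressive function `φ` codes the sequence `q` of conditions: on a club, at points of
cofinality `κ`, conditions with the same code agree. -/
def Codes (κ τ : Cardinal.{u}) (μ : Ordinal.{u} → Cardinal.{u}) (π : ZFSet.{u} → ZFSet.{u})
    (q : Idx κ → ZFSet.{u}) (φ : Idx κ → Ordinal.{u}) : Prop :=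
  (∀ i, φ i < 1 + (i : Ordinal.{u})) ∧
    ∃ C : Set (Idx κ), IsClub C ∧ ∀ i ∈ C, ∀ j ∈ C, i ≠ j →
      (i : Ordinal.{u}).cof = κ → (j : Ordinal.{u}).cof = κ → φ i = φ j →
      ∃ d d' : Cond.{u}, d.Valid κ τ μ π ∧ d'.Valid κ τ μ π ∧ q i = d.toSet τ ∧
        q j = d'.toSet τ ∧ d.Agree τ d'

theorem exists_codes (P : Params κ τ μ π) {q : Idx κ → ZFSet.{u}}
    (hq : ∀ i, q i ∈ (Q κ τ μ π).carrier) : ∃ φ, Codes κ τ μ π q φ := by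
  choose d hd hqd using fun i => (mem_carrier_iff P.mapsTo).1 (hq i)
  obtain ⟨φ, hφ, C, hC, h⟩ := exists_regressive P.reg P.pow (mk_prod_Iio_le P.reg.aleph0_le)
    (fun i => (d i).graph τ) (fun i => Cond.mk_graph_lt P (hd i))
    (fun i z hz => Cond.snd_mem_of_mem_graph P (hd i) hz)
  exact ⟨φ, hφ, C, hC, fun i hi j hj hne h1 h2 h3 => ⟨d i, d j, hd i, hd j, hqd i, hqd j,
    Cond.agree_of_graph (h i hi j hj hne h1 h2 h3)⟩⟩

/-- Player I plays the least upper bounds of the conditions played so far, together with a code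
of them. -/
noncomputable def ccStrategy (κ τ : Cardinal.{u}) (μ : Ordinal.{u} → Cardinal.{u})
    (π : ZFSet.{u} → ZFSet.{u}) : CCStrategy κ := fun α hist =>
  let q : Idx κ → ZFSet.{u} := fun i => Classical.epsilon
    ((Q κ τ μ π).IsLeastUpperBound (Set.range fun β : Set.Iio α => (hist β).p i))
  open Classical in
  (q, if α = 0 then fun _ => 0 else Classical.epsilon (Codes κ τ μ π q))

theorem isChainOn_of_legal (P : Params κ τ μ π) {play : Ordinal.{u} → CCRound κ}
    {δ : Ordinal.{u}} (h1 : ∀ α < δ, CCLegalI (Q κ τ μ π) κ play α)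
    (h2 : ∀ α < δ, CCLegalII (Q κ τ μ π) κ play α) (i : Idx κ) :
    (Q κ τ μ π).IsChainOn δ fun β => (play β).p i := by
  refine ⟨fun ξ hξ => (h2 ξ hξ i).1, fun ξ ζ h3 h4 => ?_⟩
  rcases h3.eq_or_lt with rfl | h3
  · exact le_refl' P.mapsTo (h2 ξ h4 i).1
  · exact le_trans' P.mapsTo (((h1 ζ h4).2.2 (pos_of_gt h3)).1 ξ h3 i) (h2 ζ h4 i).2

theorem ccStrategy_legal (P : Params κ τ μ π) {play : Ordinal.{u} → CCRound κ}
    (δ : Ordinal.{u}) (hδ : δ < κ.ord)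
    (h1 : ∀ α ≤ δ, CCFollows κ (ccStrategy κ τ μ π) play α)
    (h2 : ∀ α < δ, CCLegalII (Q κ τ μ π) κ play α) :
    CCLegalI (Q κ τ μ π) κ play δ ∧ (0 < δ → Codes κ τ μ π (play δ).q (play δ).φ) := by
  induction δ using WellFoundedLT.induction with
  | ind δ ih =>
  have hleg : ∀ α < δ, CCLegalI (Q κ τ μ π) κ play α := fun α hα =>
    (ih α hα (hα.trans hδ) (fun β hβ => h1 β (hβ.trans hα.le)) fun β hβ => h2 β (hβ.trans hα)).1
  have hq := congrArg Prod.fst (h1 δ le_rfl)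
  have hφ := congrArg Prod.snd (h1 δ le_rfl)
  simp only [ccStrategy] at hq hφ
  have hlub : ∀ i, (Q κ τ μ π).IsLeastUpperBound
      ((fun β => (play β).p i) '' Set.Iio δ) ((play δ).q i) := by
    intro i
    have h3 := lubComplete_Q P δ hδ _ (isChainOn_of_legal P hleg h2 i)
    have h4 : ((fun β => (play β).p i) '' Set.Iio δ) =
        Set.range fun β : Set.Iio δ => (play β).p i := Set.image_eq_range _ _
    rw [h4] at h3 ⊢
    rw [hq]
    exact Classical.epsilon_spec h3
  have hcar : ∀ i, (play δ).q i ∈ (Q κ τ μ π).carrier := fun i => (hlub i).1.1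
  have hcodes : 0 < δ → Codes κ τ μ π (play δ).q (play δ).φ := by
    intro h0
    rw [if_neg h0.ne', ← hq] at hφ
    rw [hφ]
    exact Classical.epsilon_spec (exists_codes P hcar)
  refine ⟨⟨hcar, ?_, fun h0 => ⟨fun β hβ i => (hlub i).1.2 _ ⟨β, hβ, rfl⟩, (hcodes h0).1⟩⟩, hcodes⟩
  rintro rfl i
  refine ⟨⟨hcar i, fun p hp => (hlub i).2 p ⟨hp, ?_⟩⟩, ?_⟩
  · rintro _ ⟨β, hβ, -⟩
    exact absurd (Set.mem_Iio.1 hβ) not_lt_zero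
  · rw [hφ, if_pos rfl]

theorem isClub_iInter_Idx (hκ : ℵ₀ ≤ κ) {o : Ordinal.{u}} (ho : o.card ≤ κ)
    (C : Set.Iio o → Set (Idx κ)) (hC : ∀ α, IsClub (C α)) : IsClub (⋂ α, C α) := by
  have hcof : Order.cof (Idx κ) = lift.{u + 1} (Order.succ κ) := by
    rw [Ordinal.cof_Iio, ← Ordinal.lift_cof, (isRegular_succ hκ).cof_ord]
  have hlt : ℵ₀ < lift.{u + 1} (Order.succ κ) :=
    aleph0_lt_lift.2 (Order.lt_succ_of_le hκ)
  refine IsClub.iInter (by rw [hcof]; exact hlt.ne') ?_ hC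
  rw [hcof, Cardinal.mk_Iio_ordinal, Cardinal.lift_id, Cardinal.lift_id, Cardinal.lift_lt]
  exact Order.lt_succ_of_le ho

theorem starCondition_Q (P : Params κ τ μ π) {θ : Cardinal.{u}} (hθ : ℵ₀ ≤ θ) (hθκ : θ < κ) :
    StarCondition (Q κ τ μ π) κ θ.ord := by
  have hθκ' : θ.ord < κ.ord := ord_lt_ord.2 hθκ
  refine ⟨ccStrategy κ τ μ π, fun play => ⟨fun δ hδ h1 h2 =>
    (ccStrategy_legal P δ (hδ.trans hθκ') h1 h2).1, fun h1 h2 => ?_⟩⟩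
  have hleg : ∀ α < θ.ord, CCLegalI (Q κ τ μ π) κ play α ∧
      (0 < α → Codes κ τ μ π (play α).q (play α).φ) := fun α hα =>
    ccStrategy_legal P α (hα.trans hθκ') (fun β hβ => h1 β (hβ.trans_lt hα))
      fun β hβ => h2 β (hβ.trans hα)
  have hclub : ∀ α : Set.Iio θ.ord, ∃ C : Set (Idx κ), IsClub C ∧ (0 < α.1 →
      ∀ i ∈ C, ∀ j ∈ C, i ≠ j → (i : Ordinal.{u}).cof = κ → (j : Ordinal.{u}).cof = κ →
      (play α).φ i = (play α).φ j → ∃ d d' : Cond.{u}, d.Valid κ τ μ π ∧ d'.Valid κ τ μ π ∧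
        (play α).q i = d.toSet τ ∧ (play α).q j = d'.toSet τ ∧ d.Agree τ d') := by
    intro α
    by_cases h0 : 0 < α.1
    · obtain ⟨-, C, hC, h⟩ := (hleg α α.2).2 h0
      exact ⟨C, hC, fun _ => h⟩
    · exact ⟨Set.univ, .univ, fun h => absurd h h0⟩
  choose C hC hCp using hclub
  refine ⟨⋂ α, C α, isClub_iInter_Idx P.reg.aleph0_le (by rw [card_ord]; exact hθκ.le) C hC, ?_⟩
  intro i hi j hj hne hci hcj hφ
  obtain ⟨c, D, hc, hcm, hD, -, hDU, hDi⟩ := exists_isLeastUpperBound P hθκ'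
    (isChainOn_of_legal P (fun α hα => (hleg α hα).1) h2 i)
  obtain ⟨c', D', hc', hcm', hD', -, hDU', hDi'⟩ := exists_isLeastUpperBound P hθκ'
    (isChainOn_of_legal P (fun α hα => (hleg α hα).1) h2 j)
  have hlim := isSuccLimit_ord hθ
  -- the moves of Player I at successor stages agree and are interleaved with those of Player II
  have key : ∀ ξ < θ.ord, ∃ d d' : Cond.{u}, d.Agree τ d' ∧ (c ξ).Le τ d ∧ d.Le τ D ∧
      (c' ξ).Le τ d' ∧ d'.Le τ D' := by
    intro ξ hξ
    have hζ := hlim.succ_lt hξ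
    have h0 : (0 : Ordinal.{u}) < Order.succ ξ :=
      zero_le.trans_lt (Order.lt_succ ξ)
    obtain ⟨d, d', hd, hd', e, e', hag⟩ := hCp ⟨_, hζ⟩ h0 i (Set.mem_iInter.1 hi _) j
      (Set.mem_iInter.1 hj _) hne hci hcj (hφ _ hζ)
    have h3 : ∀ k, (Q κ τ μ π).le ((play ξ).p k) ((play (Order.succ ξ)).q k) := fun k =>
      ((hleg _ hζ).1.2.2 h0).1 ξ (Order.lt_succ ξ) k
    have h4 : ∀ k, (Q κ τ μ π).le ((play (Order.succ ξ)).q k) ((play (Order.succ ξ)).p k) :=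
      fun k => (h2 _ hζ k).2
    refine ⟨d, d', hag, ?_, ?_, ?_, ?_⟩
    · rw [← toSet_le P.mapsTo (hc ξ hξ).1 hd, ← (hc ξ hξ).2.1, ← e]
      exact h3 i
    · refine Cond.Le.trans ?_ (hc _ hζ).2.2
      rw [← toSet_le P.mapsTo hd (hc _ hζ).1, ← (hc _ hζ).2.1, ← e]
      exact h4 i
    · rw [← toSet_le P.mapsTo (hc' ξ hξ).1 hd', ← (hc' ξ hξ).2.1, ← e']
      exact h3 j
    · refine Cond.Le.trans ?_ (hc' _ hζ).2.2
      rw [← toSet_le P.mapsTo hd' (hc' _ hζ).1, ← (hc' _ hζ).2.1, ← e']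
      exact h4 j
  have hii : D.i = D'.i := by
    refine le_antisymm (le_of_forall_lt fun k hk => ?_) (le_of_forall_lt fun k hk => ?_)
    · obtain ⟨ξ, hξ, h⟩ := hDi k hk
      obtain ⟨d, d', hag, h3, -, -, h4⟩ := key ξ hξ
      exact (h.trans_le h3.i_le).trans_le (hag.i_eq.trans_le h4.i_le)
    · obtain ⟨ξ, hξ, h⟩ := hDi' k hk
      obtain ⟨d, d', hag, -, h3, h4, -⟩ := key ξ hξ
      exact (h.trans_le h4.i_le).trans_le (hag.i_eq.ge.trans h3.i_le)
  have hF : ∀ σ ∈ tree τ D.U, σ ∈ tree τ D'.U → ∀ j < D.i, D.F σ j = D'.F σ j := by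
    intro σ hσ hσ' k hk
    obtain ⟨η, hη, α, hα, rfl⟩ := mem_tree.1 hσ
    obtain ⟨η', hη', α', hα', e⟩ := mem_tree.1 hσ'
    obtain ⟨ξ₁, hξ₁, g1⟩ := hDU η hη
    obtain ⟨ξ₂, hξ₂, g2⟩ := hDU' η' hη'
    obtain ⟨ξ₃, hξ₃, g3⟩ := hDi k hk
    have hξ : max ξ₁ (max ξ₂ ξ₃) < θ.ord := max_lt hξ₁ (max_lt hξ₂ hξ₃)
    obtain ⟨d, d', hag, h3, h4, h5, h6⟩ := key _ hξ
    have g4 := restr_mem_tree (τ := τ) (h3.U_subset ((hcm ξ₁ _ (le_max_left _ _) hξ).U_subset g1))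
      hα
    have g5 := restr_mem_tree (τ := τ) (h5.U_subset ((hcm' ξ₂ _
      ((le_max_left _ _).trans (le_max_right _ _)) hξ).U_subset g2)) hα'
    rw [← e] at g5
    have g6 : k < d.i := g3.trans_le ((hcm ξ₃ _
      ((le_max_right _ _).trans (le_max_right _ _)) hξ).i_le.trans h3.i_le)
    rw [← h4.F_eq _ g4 k g6, ← h6.F_eq _ g5 k (hag.i_eq ▸ g6)]
    exact hag.F_eq _ g4 g5 k g6
  have hG : ∀ η ∈ D.U, η ∈ D'.U → D.G η = D'.G η := by
    intro η hη hη'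
    obtain ⟨ξ₁, hξ₁, g1⟩ := hDU η hη
    obtain ⟨ξ₂, hξ₂, g2⟩ := hDU' η hη'
    have hξ : max ξ₁ ξ₂ < θ.ord := max_lt hξ₁ hξ₂
    obtain ⟨d, d', hag, h3, h4, h5, h6⟩ := key _ hξ
    have g4 := h3.U_subset ((hcm ξ₁ _ (le_max_left _ _) hξ).U_subset g1)
    have g5 := h5.U_subset ((hcm' ξ₂ _ (le_max_right _ _) hξ).U_subset g2)
    rw [← h4.G_eq _ g4, ← h6.G_eq _ g5]
    exact hag.G_eq _ g4 g5
  obtain ⟨e, he, hle, hle'⟩ := exists_amalgam P hD hD' hii.le hF hG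
    (fun _ _ _ h => absurd hii h.ne)
  refine ⟨e.toSet τ, toSet_mem P.mapsTo he, ?_⟩
  rintro x ⟨α, hα, rfl | rfl⟩
  · rw [(hc α hα).2.1]
    exact (toSet_le P.mapsTo (hc α hα).1 he).2 ((hc α hα).2.2.trans hle)
  · rw [(hc' α hα).2.1]
    exact (toSet_le P.mapsTo (hc' α hα).1 he).2 ((hc' α hα).2.2.trans hle')

end

/-! ### Closure of elementary submodels -/

theorem InH.mem {χ : Cardinal.{u}} {x y : ZFSet.{u}} (hx : InH χ x) (hy : y ∈ x) : InH χ y := by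
  obtain ⟨t, ht, hxt, hc⟩ := hx
  exact ⟨t, ht, ht y (hxt hy), hc⟩

theorem inH_of_lt {χ : Cardinal.{u}} {x : ZFSet.{u}}
    (h : (ZFSet.vonNeumann x.rank).card < χ) : InH χ x :=
  ⟨_, ZFSet.isTransitive_vonNeumann _, ZFSet.subset_vonNeumann_self x, h⟩

open FirstOrder FirstOrder.Language in
/-- An elementary submodel of `H(χ)` is closed under the application of its functions: the value
`v` of `s` at `a` is definable from `s` and `a`. -/
theorem Submodel.apply_mem {χ : Cardinal.{u}} {lt : HSet χ → HSet χ → Prop} (N : Submodel χ lt)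
    {s a v : ZFSet.{u}} (hs : s ∈ N.sets) (ha : a ∈ N.sets)
    (hpair : ∀ z ∈ s, ∃ x y, z = ZFSet.pair x y) (hv : ZFSet.pair a v ∈ s)
    (huniq : ∀ v', ZFSet.pair a v' ∈ s → v' = v) : v ∈ N.sets := by
  obtain ⟨hsH, hsN⟩ := hs
  obtain ⟨haH, haN⟩ := ha
  have hpH : InH χ (ZFSet.pair a v) := hsH.mem hv
  have h2 : ({a, v} : ZFSet.{u}) ∈ ZFSet.pair a v := by
    rw [ZFSet.pair]
    exact ZFSet.mem_pair.2 (Or.inr rfl)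
  have hvH : InH χ v := (hpH.mem h2).mem (ZFSet.mem_pair.2 (Or.inr rfl))
  -- `D` is `{v}`, defined in `H(χ)` from `s` and `a`: for some `z ∈ s`, `a` belongs to each
  -- member of `z`, `y` to some member of `z`, and nothing else to any member of `z`
  let D : Set (HModel χ lt) := {y | ∃ z : HSet χ, z.1 ∈ s ∧
    (∀ w : HSet χ, w.1 ∈ z.1 → a ∈ w.1) ∧
    (∃ w : HSet χ, w.1 ∈ z.1 ∧ (show HSet χ from y).1 ∈ w.1) ∧
    ∀ w : HSet χ, w.1 ∈ z.1 → ∀ t : HSet χ, t.1 ∈ w.1 →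
      t = ⟨a, haH⟩ ∨ t = y}
  have hD : D.Nonempty := by
    refine ⟨⟨v, hvH⟩, ⟨ZFSet.pair a v, hpH⟩, hv, ?_, ⟨⟨{a, v}, hpH.mem h2⟩, h2, ?_⟩, ?_⟩
    · intro w hw
      rcases ZFSet.mem_pair.1 (show w.1 ∈ ({{a}, {a, v}} : ZFSet) from hw) with h | h
      · rw [h]; exact ZFSet.mem_singleton.2 rfl
      · rw [h]; exact ZFSet.mem_pair.2 (Or.inl rfl)
    · exact ZFSet.mem_pair.2 (Or.inr rfl)
    · intro w hw t ht
      rcases ZFSet.mem_pair.1 (show w.1 ∈ ({{a}, {a, v}} : ZFSet) from hw) with h | h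
      · rw [h] at ht
        exact Or.inl (Subtype.ext (ZFSet.mem_singleton.1 ht))
      · rw [h] at ht
        exact (ZFSet.mem_pair.1 ht).imp (fun e => Subtype.ext e) (fun e => Subtype.ext e)
  have hdef : (N : Set (HModel χ lt)).Definable₁ setLang D := by
    rw [Set.Definable₁, Set.definable_iff_exists_formula_sum]
    let S : (N : Set (HModel χ lt)) := ⟨⟨s, hsH⟩, hsN⟩
    let A : (N : Set (HModel χ lt)) := ⟨⟨a, haH⟩, haN⟩
    let R : setLang.Relations 2 := SetRel.mem
    let fv : ∀ {n}, ((N : Set (HModel χ lt)) ⊕ Fin 1) →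
      setLang.Term (((N : Set (HModel χ lt)) ⊕ Fin 1) ⊕ Fin n) := fun x => Term.var (Sum.inl x)
    refine ⟨BoundedFormula.ex (R.boundedFormula₂ (&0) (fv (Sum.inl S)) ⊓
      ((R.boundedFormula₂ (&1) (&0)).imp (R.boundedFormula₂ (fv (Sum.inl A)) (&1))).all ⊓
      (R.boundedFormula₂ (&1) (&0) ⊓ R.boundedFormula₂ (fv (Sum.inr 0)) (&1)).ex ⊓
      ((R.boundedFormula₂ (&1) (&0)).imp ((R.boundedFormula₂ (&2) (&1)).imp
        ((Term.bdEqual (&2) (fv (Sum.inl A))) ⊔ (Term.bdEqual (&2) (fv (Sum.inr 0))))).all).all),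
      ?_⟩
    ext y
    simp only [Set.mem_ofPred_eq, Formula.Realize, BoundedFormula.realize_ex,
      BoundedFormula.realize_inf, BoundedFormula.realize_all, BoundedFormula.realize_imp,
      BoundedFormula.realize_sup, BoundedFormula.realize_bdEqual, BoundedFormula.realize_rel₂]
    constructor
    · rintro ⟨z, h1, h2, h3, h4⟩
      exact ⟨z, ⟨⟨h1, h2⟩, h3⟩, h4⟩
    · rintro ⟨z, ⟨⟨h1, h2⟩, h3⟩, h4⟩
      exact ⟨z, h1, h2, h3, h4⟩
  obtain ⟨y, ⟨z, hz, h3, ⟨w, hw, hyw⟩, h5⟩, hyN⟩ := N.meetsDefinable D hD hdef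
  obtain ⟨a', y', hz'⟩ := hpair z.1 hz
  have hin : ∀ w ∈ z.1, ∃ h : InH χ w, (⟨w, h⟩ : HSet χ).1 ∈ z.1 := fun w hw =>
    ⟨z.2.mem hw, hw⟩
  have g1 : ({a'} : ZFSet.{u}) ∈ z.1 := by
    rw [hz', ZFSet.pair]
    exact ZFSet.mem_pair.2 (Or.inl rfl)
  have g2 : ({a', y'} : ZFSet.{u}) ∈ z.1 := by
    rw [hz', ZFSet.pair]
    exact ZFSet.mem_pair.2 (Or.inr rfl)
  obtain rfl : a = a' := ZFSet.mem_singleton.1 (h3 ⟨_, z.2.mem g1⟩ g1)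
  have hy1 : (show HSet χ from y).1 ∈ ({a, y'} : ZFSet.{u}) := by
    rcases ZFSet.mem_pair.1 (show w.1 ∈ ({{a}, {a, y'}} : ZFSet) from by
        rw [hz'] at hw; exact hw) with h | h
    · rw [h] at hyw
      exact ZFSet.mem_pair.2 (Or.inl (ZFSet.mem_singleton.1 hyw))
    · rwa [h] at hyw
  have hy' : y' ∈ ({a, y'} : ZFSet.{u}) := ZFSet.mem_pair.2 (Or.inr rfl)
  have hyy : (show HSet χ from y).1 = y' := by
    rcases h5 ⟨_, z.2.mem g2⟩ g2 ⟨y', (z.2.mem g2).mem hy'⟩ hy' with h | h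
    · have h' : y' = a := congrArg Subtype.val h
      subst h'
      exact (ZFSet.mem_pair.1 hy1).elim id id
    · exact (congrArg Subtype.val h).symm
  have hyv : (show HSet χ from y).1 = v := by
    rw [hyy]
    exact huniq _ (hz' ▸ hz)
  refine ⟨hvH, ?_⟩
  have : (show HModel χ lt from (⟨v, hvH⟩ : HSet χ)) = y := Subtype.ext hyv.symm
  rw [this]
  exact hyN

/-- A relation that relates each set to at most `κ` many sets has a set as a parameter with which
every elementary submodel that includes `κ` is closed under the relation. -/
theorem exists_closure_parameter {κ : Cardinal.{u}} (R : ZFSet.{u} → ZFSet.{u} → Prop)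
    (D : ZFSet.{u}) (hRD : ∀ d y, R d y → d ∈ D) (hR : ∀ d, #{y | R d y} ≤ lift.{u + 1} κ) :
    ∃ (x : ZFSet.{u}) (χ₀ : Cardinal.{u}), ∀ χ ≥ χ₀, InH χ x ∧
      ∀ (lt : HSet χ → HSet χ → Prop) (N : Submodel χ lt), x ∈ N.sets →
        (∀ ξ < κ.ord, ξ.toZFSet ∈ N.sets) → ∀ d y, d ∈ N.sets → R d y → y ∈ N.sets := by
  have hex : ∀ d, ∃ h : Ordinal.{u} → ZFSet.{u}, ∀ y, R d y → ∃ ξ < κ.ord, y = h ξ := by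
    intro d
    have h1 := hR d
    rw [← mk_Iio_ord] at h1
    obtain ⟨e⟩ := h1
    refine ⟨fun ξ => Classical.epsilon fun y => ∃ hy : R d y, (e ⟨y, hy⟩ : Ordinal) = ξ,
      fun y hy => ⟨e ⟨y, hy⟩, (e ⟨y, hy⟩).2, ?_⟩⟩
    obtain ⟨h2, h3⟩ := Classical.epsilon_spec
      (p := fun y' => ∃ hy' : R d y', (e ⟨y', hy'⟩ : Ordinal) = e ⟨y, hy⟩) ⟨y, hy, rfl⟩
    exact (congrArg Subtype.val (e.injective (Subtype.ext h3))).symm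
  choose h hh using hex
  -- the parameter maps each `d ∈ D` to an enumeration, indexed by `κ`, of the `y` with `R d y`
  refine ⟨lam D fun d => lamO κ.ord (h d),
    Order.succ (ZFSet.vonNeumann (lam D fun d => lamO κ.ord (h d)).rank).card, fun χ hχ =>
    ⟨inH_of_lt ((Order.lt_succ _).trans_le hχ), fun lt N hx hκN d y hd hdy => ?_⟩⟩
  have h1 : lamO κ.ord (h d) ∈ N.sets := by
    refine N.apply_mem hx hd ?_ (pair_mem_lam.2 ⟨hRD d y hdy, rfl⟩)
      fun v' hv' => (pair_mem_lam.1 hv').2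
    intro z hz
    obtain ⟨a, -, rfl⟩ := mem_lam.1 hz
    exact ⟨_, _, rfl⟩
  obtain ⟨ξ, hξ, rfl⟩ := hh d y hdy
  refine N.apply_mem h1 (hκN ξ hξ) ?_ (pair_mem_lamO.2 ⟨hξ, rfl⟩)
    fun v' hv' => (pair_mem_lamO.1 hv').2
  intro z hz
  obtain ⟨a, -, rfl⟩ := mem_lamO.1 hz
  exact ⟨_, _, rfl⟩

/-! ### The manageability game -/

section

variable {κ τ : Cardinal.{u}} {μ : Ordinal.{u} → Cardinal.{u}} {π : ZFSet.{u} → ZFSet.{u}}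

/-- A choice of a branch through each node. -/
theorem exists_branches : ∃ br : ZFSet.{u} → ZFSet.{u},
    ∀ σ ∈ tree τ (seqs μ τ.ord), br σ ∈ seqs μ τ.ord ∧ σ ∈ tree τ {br σ} := by
  have h : ∀ σ, ∃ η, σ ∈ tree τ (seqs μ τ.ord) → η ∈ seqs μ τ.ord ∧ σ ∈ tree τ {η} := by
    intro σ
    by_cases hσ : σ ∈ tree τ (seqs μ τ.ord)
    · obtain ⟨η, hη, α, hα, rfl⟩ := mem_tree.1 hσ
      exact ⟨η, fun _ => ⟨hη, restr_mem_tree (ZFSet.mem_singleton.2 rfl) hα⟩⟩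
    · exact ⟨∅, fun h => absurd h hσ⟩
  choose br hbr using h
  exact ⟨br, hbr⟩

/-- The closure properties of a set `N` used in the manageability game. The function `br` chooses a
branch through each node. -/
structure Closed (κ τ : Cardinal.{u}) (μ : Ordinal.{u} → Cardinal.{u})
    (π : ZFSet.{u} → ZFSet.{u}) (br : ZFSet.{u} → ZFSet.{u}) (N : Set ZFSet.{u}) : Prop where
  branch_mem : ∀ d : Cond.{u}, d.Valid κ τ μ π → d.toSet τ ∈ N → ∀ η ∈ d.U, η ∈ N
  restr_mem : ∀ η ∈ seqs μ τ.ord, η ∈ N → ∀ α < τ.ord, restr η α ∈ N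
  br_mem : ∀ σ ∈ tree τ (seqs μ τ.ord), σ ∈ N → br σ ∈ N
  mem_of_restr : ∀ η ∈ seqs μ τ.ord, (∀ α < τ.ord, restr η α ∈ N) → η ∈ N
  cond_mem : ∀ d : Cond.{u}, d.Valid κ τ μ π → (∀ η ∈ d.U, η ∈ N) → d.toSet τ ∈ N

/-- At most `κ` many conditions have a given set of branches, as a condition is determined by its
branches and its graph, which is a small subset of a set of size `κ`. -/
theorem mk_conditions_le (P : Params κ τ μ π) (A : Set ZFSet.{u}) :
    #{y | ∃ d : Cond.{u}, d.Valid κ τ μ π ∧ y = d.toSet τ ∧ ∀ η, η ∈ d.U ↔ η ∈ A} ≤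
      lift.{u + 1} κ := by
  have h0 : ℵ₀ ≤ lift.{u + 1} κ := aleph0_le_lift.2 P.reg.aleph0_le
  by_cases hne : ∃ U : ZFSet.{u}, U.card < κ ∧ ∀ η, η ∈ U ↔ η ∈ A
  swap
  · have : {y | ∃ d : Cond.{u}, d.Valid κ τ μ π ∧ y = d.toSet τ ∧ ∀ η, η ∈ d.U ↔ η ∈ A} = ∅ :=
      Set.eq_empty_of_forall_notMem fun y ⟨d, hd, _, h⟩ => hne ⟨d.U, hd.card_lt, h⟩
    rw [this]
    simp
  obtain ⟨U, hUc, hU⟩ := hne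
  let K : Set ZFSet.{u} := insert ∅ ({η | η ∈ U} ∪ {σ | σ ∈ tree τ U})
  have hK : #K ≤ lift.{u + 1} κ := by
    refine mk_insert_le.trans (add_le_of_le h0 ((mk_union_le _ _).trans
      (add_le_of_le h0 (mk_coe_lt.2 hUc).le (mk_tree_lt P.reg P.tau_lt hUc).le))
      (one_le_aleph0.trans h0))
  let Z : Set ((ℕ × ZFSet.{u}) × (Ordinal.{u} × Ordinal.{u})) :=
    ((Set.univ : Set ℕ) ×ˢ K) ×ˢ (Set.Iio κ.ord ×ˢ Set.Iio κ.ord)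
  have hZ : #Z ≤ lift.{u + 1} κ := by
    rw [mk_congr (Equiv.Set.prod _ _), mk_prod, Cardinal.lift_id, Cardinal.lift_id]
    refine mul_le_of_le h0 ?_ (mk_prod_Iio_le P.reg.aleph0_le)
    rw [mk_congr (Equiv.Set.prod _ _), mk_prod]
    refine mul_le_of_le h0 ?_ (by simpa using hK)
    simpa using P.reg.aleph0_le
  obtain ⟨c, hc, hcinj⟩ := exists_code_of_small_subsets P.reg P.pow Z hZ
  choose d hd hyd hdA using fun y : {y | ∃ d : Cond.{u}, d.Valid κ τ μ π ∧ y = d.toSet τ ∧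
    ∀ η, η ∈ d.U ↔ η ∈ A} => y.2
  have hdU : ∀ y, (d y).U = U := fun y => ZFSet.ext fun z => (hdA y z).trans (hU z).symm
  have hgZ : ∀ y, (d y).graph τ ⊆ Z := by
    rintro y z hz
    refine ⟨⟨trivial, ?_⟩, Cond.snd_mem_of_mem_graph P (hd y) hz⟩
    rcases hz with (rfl | ⟨η, hη, rfl⟩) | ⟨⟨σ, j⟩, ⟨hσ, hj⟩, rfl⟩
    · exact Set.mem_insert _ _
    · exact Or.inr (Or.inl (hdU y ▸ hη))
    · exact Or.inr (Or.inr (hdU y ▸ hσ))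
  rw [← mk_Iio_ord]
  refine mk_le_of_injective (f := fun y => ⟨c ((d y).graph τ), hc _⟩) fun y y' h => ?_
  have h1 : (d y).graph τ = (d y').graph τ := hcinj ⟨hgZ y, Cond.mk_graph_lt P (hd y)⟩
    ⟨hgZ y', Cond.mk_graph_lt P (hd y')⟩ (congrArg Subtype.val h)
  have hle : ∀ y y', (d y).graph τ = (d y').graph τ → (d y).Le τ (d y') := by
    intro y y' h1
    have h2 : (d y).Agree τ (d y') := Cond.agree_of_graph fun _ _ _ hx _ => h1 ▸ hx
    have h3 : (d y).U = (d y').U := (hdU y).trans (hdU y').symm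
    exact ⟨h2.i_eq.le, fun η hη => h3 ▸ hη, fun η hη => h2.G_eq η hη (h3 ▸ hη),
      fun σ hσ j hj => h2.F_eq σ hσ (h3 ▸ hσ) j hj⟩
  exact Subtype.ext ((hyd y).trans ((Cond.Le.toSet_eq (hle y y' h1) (hle y' y h1.symm)).trans
    (hyd y').symm))

/-- Each small set is the range of a sequence of length less than `κ`. -/
theorem exists_enumeration {U : ZFSet.{u}} (hU : U.card < κ) :
    ∃ δ < κ.ord, ∃ k : Ordinal.{u} → ZFSet.{u}, ∀ η, η ∈ U ↔ ∃ ξ < δ, η = k ξ := by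
  have h1 : #U = #(Set.Iio U.card.ord) := by rw [mk_Iio_ord, ZFSet.cardinalMk_coe_sort]
  obtain ⟨e⟩ := Cardinal.eq.1 h1
  have h2 : ∀ ξ, ∃ v : ZFSet.{u}, ∀ h : ξ ∈ Set.Iio U.card.ord, v = e.symm ⟨ξ, h⟩ := by
    intro ξ
    by_cases h : ξ ∈ Set.Iio U.card.ord
    · exact ⟨e.symm ⟨ξ, h⟩, fun _ => rfl⟩
    · exact ⟨∅, fun h' => absurd h' h⟩
  choose k hk using h2
  refine ⟨U.card.ord, ord_lt_ord.2 hU, k, fun η => ⟨fun hη => ?_, ?_⟩⟩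
  · refine ⟨e ⟨η, hη⟩, (e ⟨η, hη⟩).2, ?_⟩
    rw [hk _ (e ⟨η, hη⟩).2]
    simp
  · rintro ⟨ξ, hξ, rfl⟩
    rw [hk ξ hξ]
    exact (e.symm ⟨ξ, hξ⟩).2

/-- The finitely many operations under which `N` is closed, collected in one relation. Conditions
are obtained from enumerations of their sets of branches. -/
def ClosureRel (κ τ : Cardinal.{u}) (μ : Ordinal.{u} → Cardinal.{u})
    (π : ZFSet.{u} → ZFSet.{u}) (br : ZFSet.{u} → ZFSet.{u}) (d y : ZFSet.{u}) : Prop :=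
  (∃ c : Cond.{u}, c.Valid κ τ μ π ∧ d = c.toSet τ ∧ y ∈ c.U) ∨
  (d ∈ seqs μ τ.ord ∧ ∃ α < τ.ord, y = restr d α) ∨
  (d ∈ tree τ (seqs μ τ.ord) ∧ y = br d) ∨
  (y ∈ seqs μ τ.ord ∧ d = lamO τ.ord fun α => restr y α) ∨
  (∃ c : Cond.{u}, c.Valid κ τ μ π ∧ y = c.toSet τ ∧
    (∃ δ < κ.ord, ∃ k, d = lamO δ k) ∧ ∀ η, η ∈ c.U ↔ ∃ a, ZFSet.pair a η ∈ d)

theorem mk_closureRel_le (P : Params κ τ μ π) (br : ZFSet.{u} → ZFSet.{u}) (d : ZFSet.{u}) :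
    #{y | ClosureRel κ τ μ π br d y} ≤ lift.{u + 1} κ := by
  have h0 : ℵ₀ ≤ lift.{u + 1} κ := aleph0_le_lift.2 P.reg.aleph0_le
  have hsing : ∀ s : Set ZFSet.{u}, s.Subsingleton → #s ≤ lift.{u + 1} κ := fun s hs =>
    (mk_le_one_iff_set_subsingleton.2 hs).trans (one_le_aleph0.trans h0)
  refine (mk_union_le _ _).trans (add_le_of_le h0 ?_ ((mk_union_le _ _).trans
    (add_le_of_le h0 ?_ ((mk_union_le _ _).trans (add_le_of_le h0 ?_
      ((mk_union_le _ _).trans (add_le_of_le h0 ?_ ?_)))))))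
  · by_cases h : ∃ c : Cond.{u}, c.Valid κ τ μ π ∧ d = c.toSet τ
    · obtain ⟨c, hc, rfl⟩ := h
      refine (mk_le_mk_of_subset (t := {η | η ∈ c.U}) ?_).trans (mk_coe_lt.2 hc.card_lt).le
      rintro y ⟨c', -, e, hy⟩
      rwa [← (tuple_inj e).2.1] at hy
    · refine hsing _ fun y hy => ?_
      obtain ⟨c, hc, e, -⟩ := hy
      exact absurd ⟨c, hc, e⟩ h
  · refine (mk_le_mk_of_subset (t := Set.range fun α : Set.Iio τ.ord => restr d α) ?_).trans ?_
    · rintro y ⟨-, α, hα, rfl⟩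
      exact ⟨⟨α, hα⟩, rfl⟩
    · refine mk_range_le.trans ?_
      rw [mk_Iio_ord]
      exact Cardinal.lift_le.2 P.tau_lt.le
  · refine hsing _ ?_
    rintro y ⟨-, rfl⟩ y' ⟨-, rfl⟩
    rfl
  · refine hsing _ ?_
    rintro y ⟨hy, e⟩ y' ⟨hy', e'⟩
    exact seqs_ext (isSuccLimit_ord P.tau_reg.aleph0_le) hy hy'
      fun α hα => lamO_inj (e.symm.trans e') hα
  · refine (mk_le_mk_of_subset ?_).trans (mk_conditions_le P {η | ∃ a, ZFSet.pair a η ∈ d})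
    rintro y ⟨c, hc, e, -, h⟩
    exact ⟨c, hc, e, h⟩

theorem exists_closureRel_domain (P : Params κ τ μ π) (br : ZFSet.{u} → ZFSet.{u}) :
    ∃ D : ZFSet.{u}, ∀ d y, ClosureRel κ τ μ π br d y → d ∈ D := by
  refine ⟨(Q κ τ μ π).carrier ∪ (seqs μ τ.ord ∪ (tree τ (seqs μ τ.ord) ∪
    (ZFSet.powerset (τ.ord.toZFSet.prod (tree τ (seqs μ τ.ord))) ∪
      ZFSet.powerset ((cardSet κ).prod (seqs μ τ.ord))))), ?_⟩
  intro d y h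
  simp only [ZFSet.mem_union]
  rcases h with ⟨c, hc, rfl, -⟩ | ⟨hd, -⟩ | ⟨hd, -⟩ | ⟨hy, rfl⟩ | ⟨c, hc, -, ⟨δ, hδ, k, rfl⟩, h⟩
  · exact Or.inl (toSet_mem P.mapsTo hc)
  · exact Or.inr (Or.inl hd)
  · exact Or.inr (Or.inr (Or.inl hd))
  · refine Or.inr (Or.inr (Or.inr (Or.inl (ZFSet.mem_powerset.2 fun z hz => ?_))))
    obtain ⟨j, hj, rfl⟩ := mem_lamO.1 hz
    exact ZFSet.pair_mem_prod.2 ⟨Ordinal.toZFSet_mem_toZFSet_iff.2 hj, restr_mem_tree hy hj⟩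
  · refine Or.inr (Or.inr (Or.inr (Or.inr (ZFSet.mem_powerset.2 fun z hz => ?_))))
    obtain ⟨j, hj, rfl⟩ := mem_lamO.1 hz
    exact ZFSet.pair_mem_prod.2 ⟨Ordinal.toZFSet_mem_toZFSet_iff.2 (hj.trans hδ),
      hc.subset ((h _).2 ⟨_, hz⟩)⟩

theorem closed_of_relevant (P : Params κ τ μ π) {br : ZFSet.{u} → ZFSet.{u}}
    {ι : Cardinal.{u}} {N : Set ZFSet.{u}}
    (hN : IsRelevant (Q κ τ μ π) κ ι N)
    (h : ∀ d y, d ∈ N → ClosureRel κ τ μ π br d y → y ∈ N) : Closed κ τ μ π br N where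
  branch_mem d hd hdN η hη := h _ η hdN (Or.inl ⟨d, hd, rfl, hη⟩)
  restr_mem η hη hηN α hα := h η _ hηN (Or.inr (Or.inl ⟨hη, α, hα, rfl⟩))
  br_mem σ hσ hσN := h σ _ hσN (Or.inr (Or.inr (Or.inl ⟨hσ, rfl⟩)))
  mem_of_restr η hη hr := by
    refine h (lamO τ.ord fun α => restr η α) η ?_ (Or.inr (Or.inr (Or.inr (Or.inl ⟨hη, rfl⟩))))
    refine hN.closed τ.ord (ord_lt_ord.2 P.tau_lt) (tree τ {η}) (fun v hv => ?_) _
      (lamO_mem_funs fun j hj => restr_mem_tree (ZFSet.mem_singleton.2 rfl) hj)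
    obtain ⟨η', hη', α, hα, rfl⟩ := mem_tree.1 hv
    rw [ZFSet.mem_singleton.1 hη']
    exact hr α hα
  cond_mem d hd hU := by
    obtain ⟨δ, hδ, k, hk⟩ := exists_enumeration hd.card_lt
    refine h (lamO δ k) _ ?_ (Or.inr (Or.inr (Or.inr (Or.inr ⟨d, hd, rfl, ⟨δ, hδ, k, rfl⟩, ?_⟩))))
    · exact hN.closed δ hδ d.U hU _ (lamO_mem_funs fun j hj => (hk _).2 ⟨j, hj, rfl⟩)
    · intro η
      rw [hk]
      constructor
      · rintro ⟨ξ, hξ, rfl⟩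
        exact ⟨ξ.toZFSet, pair_mem_lamO.2 ⟨hξ, rfl⟩⟩
      · rintro ⟨a, ha⟩
        obtain ⟨j, hj, e⟩ := mem_lamO.1 ha
        exact ⟨j, hj, (ZFSet.pair_inj.1 e).2⟩

/-- The condition `a` is the restriction of the condition `b` to `N`: it has the same height, and
all branches and nodes of `b` that belong to `N`. -/
structure Reflects (τ : Cardinal.{u}) (N : Set ZFSet.{u}) (a b : Cond.{u}) : Prop where
  le : a.Le τ b
  i_le : b.i ≤ a.i
  branch : ∀ η ∈ b.U, η ∈ N → η ∈ a.U
  node : ∀ σ ∈ tree τ b.U, σ ∈ N → σ ∈ tree τ a.U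

/-- Her move: extend `b` by a branch in `N` through each of its nodes in `N`, and restrict the
result to `N`. -/
theorem exists_reflects (P : Params κ τ μ π) {br : ZFSet.{u} → ZFSet.{u}}
    (hbr : ∀ σ ∈ tree τ (seqs μ τ.ord), br σ ∈ seqs μ τ.ord ∧ σ ∈ tree τ {br σ})
    {N : Set ZFSet.{u}} (hN : Closed κ τ μ π br N) {a b : Cond.{u}} (ha : a.Valid κ τ μ π)
    (hb : b.Valid κ τ μ π) (haN : a.toSet τ ∈ N) (hab : a.Le τ b) :
    ∃ a' b' : Cond.{u}, a'.Valid κ τ μ π ∧ b'.Valid κ τ μ π ∧ a'.toSet τ ∈ N ∧ a.Le τ a' ∧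
      b.Le τ b' ∧ Reflects τ N a' b' := by
  classical
  let T : ZFSet.{u} := ZFSet.sep (fun σ => σ ∈ N) (tree τ b.U)
  have hT : ∀ σ, σ ∈ T ↔ σ ∈ tree τ b.U ∧ σ ∈ N := fun σ => ZFSet.mem_sep
  let V : ZFSet.{u} := ZFSet.range fun σ : T => br σ
  have hV : ∀ η, η ∈ V ↔ ∃ σ, (σ ∈ tree τ b.U ∧ σ ∈ N) ∧ br σ = η := fun η => by
    simp only [V, ZFSet.mem_range, Subtype.exists, hT, exists_prop]
  have hVs : V ⊆ seqs μ τ.ord := by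
    intro η hη
    obtain ⟨σ, ⟨h1, -⟩, rfl⟩ := (hV η).1 hη
    exact (hbr σ (tree_mono hb.subset h1)).1
  have hVc : V.card < κ := by
    rw [← mk_coe_lt]
    have h1 : (V : Set ZFSet.{u}) ⊆ br '' {σ | σ ∈ tree τ b.U} := by
      intro η hη
      obtain ⟨σ, ⟨h1, -⟩, rfl⟩ := (hV η).1 hη
      exact ⟨σ, h1, rfl⟩
    exact (mk_le_mk_of_subset h1).trans_lt
      (mk_image_le.trans_lt (mk_tree_lt P.reg P.tau_lt hb.card_lt))
  obtain ⟨b', hb', hbb', hi, hU, -⟩ := exists_extension P hb hVs hVc le_rfl hb.lt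
    (fun _ _ => 0) (fun _ _ _ => P.reg.ord_pos)
  let U' : ZFSet.{u} := ZFSet.sep (fun η => η ∈ N) b'.U
  have hU' : ∀ η, η ∈ U' ↔ η ∈ b'.U ∧ η ∈ N := fun η => ZFSet.mem_sep
  have hsub : U' ⊆ b'.U := fun η hη => ((hU' η).1 hη).1
  have ha' : Cond.Valid κ τ μ π ⟨b'.i, U', b'.F, b'.G⟩ :=
    ⟨hb'.lt, fun η hη => hb'.subset (hsub hη), (ZFSet.card_mono hsub).trans_lt hb'.card_lt,
      fun σ hσ => hb'.F_lt σ (tree_mono hsub hσ), fun η hη => hb'.G_le η (hsub hη),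
      fun η hη => hb'.bound η (hsub hη)⟩
  have hle := hab.trans hbb'
  refine ⟨_, b', ha', hb', hN.cond_mem _ ha' fun η hη => ((hU' η).1 hη).2,
    ⟨hle.i_le, fun η hη => (hU' η).2 ⟨hle.U_subset hη, hN.branch_mem a ha haN η hη⟩,
      hle.G_eq, hle.F_eq⟩, hbb', ⟨⟨le_rfl, hsub, fun _ _ => rfl, fun _ _ _ _ => rfl⟩, le_rfl,
      fun η h1 h2 => (hU' η).2 ⟨h1, h2⟩, fun σ hσ hσN => ?_⟩⟩
  -- a node of the extension in `N` lies on one of the added branches, which belongs to `N`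
  have hVN : ∀ η ∈ V, η ∈ U' := by
    intro η hη
    refine (hU' η).2 ⟨by rw [hU]; exact ZFSet.mem_union.2 (Or.inr hη), ?_⟩
    obtain ⟨ρ, ⟨h1, h2⟩, rfl⟩ := (hV η).1 hη
    exact hN.br_mem ρ (tree_mono hb.subset h1) h2
  rw [hU] at hσ
  rcases mem_tree_union.1 hσ with h | h
  · have h1 := (hV (br σ)).2 ⟨σ, ⟨h, hσN⟩, rfl⟩
    refine tree_mono (fun η hη => ?_) (hbr σ (tree_mono hb.subset h)).2
    rw [ZFSet.mem_singleton.1 hη]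
    exact hVN _ h1
  · exact tree_mono hVN h

/-- The relation between Her move `y` and the move `x` of Him that She answers. -/
def Answers (κ τ : Cardinal.{u}) (μ : Ordinal.{u} → Cardinal.{u})
    (π : ZFSet.{u} → ZFSet.{u}) (N : Set ZFSet.{u}) (x y : ZFSet.{u} × ZFSet.{u}) : Prop :=
  ∃ a b : Cond.{u}, a.Valid κ τ μ π ∧ b.Valid κ τ μ π ∧ y.1 = a.toSet τ ∧ y.2 = b.toSet τ ∧
    y.1 ∈ N ∧ (Q κ τ μ π).le x.1 y.1 ∧ (Q κ τ μ π).le x.2 y.2 ∧ Reflects τ N a b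

open Classical in
/-- Her strategy: at the odd stage `2 * β + 1` answer the move at stage `2 * β`. -/
noncomputable def mStrategy (κ τ : Cardinal.{u}) (μ : Ordinal.{u} → Cardinal.{u})
    (π : ZFSet.{u} → ZFSet.{u}) (N : Set ZFSet.{u}) : MStrategy.{u} := fun i hist =>
  if h : 2 * (i / 2) < i then
    Classical.epsilon (Answers κ τ μ π N (hist ⟨2 * (i / 2), h⟩))
  else (∅, ∅)

theorem two_mul_mod_two (β : Ordinal.{u}) : (2 * β) % 2 = 0 := by simp

theorem eq_two_mul_div_add (i : Ordinal.{u}) (hi : i % 2 = 1) : i = 2 * (i / 2) + 1 := by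
  conv_lhs => rw [← Ordinal.div_add_mod i 2, hi]

theorem mod_two_eq (i : Ordinal.{u}) : i % 2 = 0 ∨ i % 2 = 1 := by
  have h : i % 2 < 1 + 1 := by
    rw [one_add_one_eq_two]
    exact Ordinal.mod_lt i two_ne_zero
  rcases (Order.lt_add_one_iff.1 h).lt_or_eq with h | h
  · exact Or.inl (Order.lt_one_iff.1 h)
  · exact Or.inr h

theorem answers_of_follows (P : Params κ τ μ π) {br : ZFSet.{u} → ZFSet.{u}}
    (hbr : ∀ σ ∈ tree τ (seqs μ τ.ord), br σ ∈ seqs μ τ.ord ∧ σ ∈ tree τ {br σ})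
    {N : Set ZFSet.{u}} (hN : Closed κ τ μ π br N) {q p : Ordinal.{u} → ZFSet.{u}}
    {β : Ordinal.{u}} (hleg : MLegal (Q κ τ μ π) N q p (2 * β))
    (hf : MFollows (mStrategy κ τ μ π N) q p (2 * β + 1)) :
    Answers κ τ μ π N (q (2 * β), p (2 * β)) (q (2 * β + 1), p (2 * β + 1)) := by
  have hdiv : (2 * β + 1) / 2 = β := by
    rw [Ordinal.mul_add_div _ two_ne_zero, Ordinal.div_eq_zero_of_lt one_lt_two, add_zero]
  have hlt : 2 * ((2 * β + 1) / 2) < 2 * β + 1 := by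
    rw [hdiv]
    exact Order.lt_add_one_iff.2 le_rfl
  rw [MFollows, mStrategy, dif_pos hlt] at hf
  simp only [hdiv] at hf
  rw [hf]
  obtain ⟨a, ha, ea⟩ := (mem_carrier_iff P.mapsTo).1 hleg.q_mem
  obtain ⟨b, hb, eb⟩ := (mem_carrier_iff P.mapsTo).1 hleg.p_mem
  have haN : a.toSet τ ∈ N := ea ▸ hleg.q_mem_model
  have hab : a.Le τ b := by
    rw [← toSet_le P.mapsTo ha hb, ← ea, ← eb]
    exact hleg.q_le_p
  obtain ⟨a', b', ha', hb', haN', haa, hbb, hr⟩ := exists_reflects P hbr hN ha hb haN hab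
  refine Classical.epsilon_spec (p := Answers κ τ μ π N (q (2 * β), p (2 * β)))
    ⟨(a'.toSet τ, b'.toSet τ), a', b', ha', hb', rfl, rfl, haN', ?_, ?_, hr⟩
  · rw [ea]
    exact (toSet_le P.mapsTo ha ha').2 haa
  · rw [eb]
    exact (toSet_le P.mapsTo hb hb').2 hbb

/-- At the end of the game the condition `q'` has all nodes of `p_θ` in `N`. A branch of `p_θ`
that is missing in `q'` does not belong to `N`, hence has a node outside `N`, so that the two
conditions can be amalgamated. -/
theorem sheWins_Q (P : Params κ τ μ π) {br : ZFSet.{u} → ZFSet.{u}}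
    (hbr : ∀ σ ∈ tree τ (seqs μ τ.ord), br σ ∈ seqs μ τ.ord ∧ σ ∈ tree τ {br σ})
    {N : Set ZFSet.{u}} (hN : Closed κ τ μ π br N) {θ : Cardinal.{u}} (hθ : ℵ₀ ≤ θ)
    (hθκ : θ < κ) : SheWins (Q κ τ μ π) N θ := by
  refine ⟨mStrategy κ τ μ π N, fun q p δ hδ heven hodd => ?_⟩
  have hans : ∀ β, 2 * β + 1 < δ → Answers κ τ μ π N (q (2 * β), p (2 * β))
      (q (2 * β + 1), p (2 * β + 1)) := by
    intro β hβ
    refine answers_of_follows P hbr hN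
      (heven _ ((Order.lt_add_one_iff.2 le_rfl).trans hβ) (two_mul_mod_two β)) (hodd _ hβ ?_)
    rw [Ordinal.mul_add_mod_self, Ordinal.mod_eq_of_lt one_lt_two]
  have hoddleg : ∀ i < δ, i % 2 = 1 → MLegal (Q κ τ μ π) N q p i := by
    intro i hi hmod
    have e := eq_two_mul_div_add i hmod
    generalize i / 2 = β at e
    subst e
    have hβδ : 2 * β < δ := (Order.lt_add_one_iff.2 le_rfl).trans hi
    obtain ⟨a, b, ha, hb, ea, eb, haN, h1, h2, hr⟩ := hans β hi
    dsimp only at ea eb haN h1 h2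
    refine ⟨ea ▸ toSet_mem P.mapsTo ha, haN, eb ▸ toSet_mem P.mapsTo hb, ?_, fun j hj => ?_⟩
    · rw [ea, eb]
      exact (toSet_le P.mapsTo ha hb).2 hr.le
    · rcases (Order.lt_add_one_iff.1 hj).eq_or_lt with rfl | hj
      · exact ⟨h1, h2⟩
      · have h3 := (heven _ hβδ (two_mul_mod_two β)).increasing j hj
        exact ⟨le_trans' P.mapsTo h3.1 h1, le_trans' P.mapsTo h3.2 h2⟩
  refine ⟨hoddleg, ?_⟩
  rintro rfl pθ qθ hpθ hqθ q' hq' hq'N hqq'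
  have hθκ' : θ.ord < κ.ord := ord_lt_ord.2 hθκ
  have hlim := isSuccLimit_ord hθ
  have hleg : ∀ i < θ.ord, MLegal (Q κ τ μ π) N q p i := fun i hi =>
    (mod_two_eq i).elim (heven i hi) (hoddleg i hi)
  have hchain : (Q κ τ μ π).IsChainOn θ.ord p := by
    refine ⟨fun ξ hξ => (hleg ξ hξ).p_mem, fun ξ ζ h1 h2 => ?_⟩
    rcases h1.eq_or_lt with rfl | h1
    · exact le_refl' P.mapsTo (hleg _ h2).p_mem
    · exact ((hleg ζ h2).increasing ξ h1).2
  obtain ⟨c, D, hc, hcm, hD, hDlub, hDU, hDi⟩ := exists_isLeastUpperBound P hθκ' hchain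
  obtain rfl : pθ = D.toSet τ :=
    le_antisymm' P.mapsTo (hpθ.2 _ hDlub.1) (hDlub.2 _ hpθ.1)
  obtain ⟨e, he, rfl⟩ := (mem_carrier_iff P.mapsTo).1 hq'
  -- cofinally many moves are Hers
  have key : ∀ ξ < θ.ord, ∃ a b : Cond.{u}, Reflects τ N a b ∧ (c ξ).Le τ b ∧ b.Le τ D ∧
      a.Le τ e := by
    intro ξ hξ
    have h1 : ξ ≤ 2 * (ξ / 2) + 1 := by
      rcases mod_two_eq ξ with h | h
      · have := Ordinal.div_add_mod ξ 2
        rw [h, add_zero] at this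
        rw [this]
        exact le_self_add
      · exact (eq_two_mul_div_add ξ h).le
    have h2 : 2 * (ξ / 2) + 1 < θ.ord := by
      refine lt_of_le_of_lt ?_ (hlim.succ_lt hξ)
      rw [Order.succ_eq_add_one]
      gcongr
      exact Ordinal.mul_div_le ξ 2
    obtain ⟨a, b, ha, hb, ea, eb, -, -, -, hr⟩ := hans _ h2
    dsimp only at ea eb
    refine ⟨a, b, hr, ?_, ?_, ?_⟩
    · rw [← toSet_le P.mapsTo (hc ξ hξ).1 hb, ← (hc ξ hξ).2.1, ← eb]
      exact hchain.2 _ _ h1 h2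
    · rw [← toSet_le P.mapsTo hb hD, ← eb]
      exact hDlub.1.2 _ ⟨_, h2, rfl⟩
    · rw [← toSet_le P.mapsTo ha he, ← ea]
      exact le_trans' P.mapsTo (hqθ.1.2 _ ⟨_, h2, rfl⟩) hqq'
  have heN : ∀ η ∈ e.U, η ∈ N := hN.branch_mem e he hq'N
  have hnodeN : ∀ σ ∈ tree τ e.U, σ ∈ N := by
    intro σ hσ
    obtain ⟨η, hη, α, hα, rfl⟩ := mem_tree.1 hσ
    exact hN.restr_mem η (he.subset hη) (heN η hη) α hα
  have hi : D.i ≤ e.i := by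
    refine le_of_forall_lt fun j hj => ?_
    obtain ⟨ξ, hξ, h⟩ := hDi j hj
    obtain ⟨a, b, hr, h1, -, h2⟩ := key ξ hξ
    exact (((h.trans_le h1.i_le).trans_le hr.i_le).trans_le h2.i_le)
  have hF : ∀ σ ∈ tree τ D.U, σ ∈ tree τ e.U → ∀ j < D.i, D.F σ j = e.F σ j := by
    intro σ hσ hσe j hj
    obtain ⟨η, hη, α, hα, rfl⟩ := mem_tree.1 hσ
    obtain ⟨ξ₁, hξ₁, g1⟩ := hDU η hη
    obtain ⟨ξ₂, hξ₂, g2⟩ := hDi j hj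
    have hξ : max ξ₁ ξ₂ < θ.ord := max_lt hξ₁ hξ₂
    obtain ⟨a, b, hr, h1, h2, h3⟩ := key _ hξ
    have g3 := restr_mem_tree (τ := τ)
      (h1.U_subset ((hcm ξ₁ _ (le_max_left _ _) hξ).U_subset g1)) hα
    have g4 : j < b.i := g2.trans_le ((hcm ξ₂ _ (le_max_right _ _) hξ).i_le.trans h1.i_le)
    have g5 := hr.node _ g3 (hnodeN _ hσe)
    have g6 := g4.trans_le hr.i_le
    rw [← h2.F_eq _ g3 j g4, ← hr.le.F_eq _ g5 j g6, h3.F_eq _ g5 j g6]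
  have hbranch : ∀ η ∈ D.U, η ∈ N → ∃ a b : Cond.{u}, Reflects τ N a b ∧ b.Le τ D ∧ a.Le τ e ∧
      η ∈ a.U := by
    intro η hη hηN
    obtain ⟨ξ, hξ, g1⟩ := hDU η hη
    obtain ⟨a, b, hr, h1, h2, h3⟩ := key ξ hξ
    exact ⟨a, b, hr, h2, h3, hr.branch η (h1.U_subset g1) hηN⟩
  have hG : ∀ η ∈ D.U, η ∈ e.U → D.G η = e.G η := by
    intro η hη hηe
    obtain ⟨a, b, hr, h2, h3, g⟩ := hbranch η hη (heN η hηe)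
    rw [← h3.G_eq η g, hr.le.G_eq η g, h2.G_eq η (hr.le.U_subset g)]
  have hfree : ∀ η ∈ D.U, η ∉ e.U → D.i < e.i → ∃ α < τ.ord, restr η α ∉ tree τ e.U := by
    intro η hη hηe _
    by_contra! hcon
    have hηN : η ∈ N := hN.mem_of_restr η (hD.subset hη) fun α hα => hnodeN _ (hcon α hα)
    obtain ⟨a, b, -, -, h3, g⟩ := hbranch η hη hηN
    exact hηe (h3.U_subset g)
  obtain ⟨r, hr, h1, h2⟩ := exists_amalgam P hD he hi hF hG hfree
  exact ⟨r.toSet τ, toSet_mem P.mapsTo hr, (toSet_le P.mapsTo he hr).2 h2,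
    (toSet_le P.mapsTo hD hr).2 h1⟩

theorem le_of_powerlt_eq {ι : Cardinal.{u}} (h1 : 1 < ι) (h : ι ^< κ = ι) : κ ≤ ι := by
  by_contra! hlt
  exact ((cantor' ι h1).trans_le (le_powerlt ι hlt)).ne' h

theorem manageable_Q (P : Params κ τ μ π) {θ ι : Cardinal.{u}} (hθ : ℵ₀ ≤ θ) (hθκ : θ < κ)
    (hθι : θ < ι) (hι : ι ^< κ = ι) : Manageable (Q κ τ μ π) θ ι κ := by
  have hlub := lubComplete_Q P
  refine ⟨fun δ hδ s hs => ?_, ⟨fun δ hδ s hs => ?_, ?_⟩, starCondition_Q P hθ hθκ⟩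
  · obtain ⟨b, hb⟩ := hlub δ hδ s hs
    exact ⟨b, hb.1⟩
  · exact hlub δ (hδ.trans_le (ord_le_ord.2 (Order.succ_le_of_lt hθκ))) s hs
  · obtain ⟨br, hbr⟩ := exists_branches
    obtain ⟨D, hD⟩ := exists_closureRel_domain P br
    obtain ⟨x, χ₀, hx⟩ := exists_closure_parameter _ D hD (mk_closureRel_le P br)
    refine ⟨χ₀, fun χ hχ _ lt _ => ⟨x, (hx χ hχ).1, fun N hN hxN => ?_⟩⟩
    have hκι := le_of_powerlt_eq ((one_lt_aleph0.trans_le hθ).trans hθι) hι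
    refine sheWins_Q P hbr (closed_of_relevant P hN ((hx χ hχ).2 lt N hxN fun ξ hξ => ?_)) hθ hθκ
    exact hN.card_subset _ (Ordinal.toZFSet_mem_toZFSet_iff.2
      (hξ.trans_le (ord_le_ord.2 hκι)))

end

end Manageability

open Manageability in
theorem theorem6
    (κ τ : Cardinal.{u}) (μ : Ordinal.{u} → Cardinal.{u}) (π : ZFSet.{u} → ZFSet.{u})
    (hκ : κ.IsRegular) (hκ_unc : ℵ₀ < κ) (hκ_pow : (2 : Cardinal.{u}) ^< κ = κ)
    (hτ : τ.IsRegular) (hτκ : τ < κ)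
    (hμ_mono : ∀ α β, α ≤ β → β < τ.ord → μ α ≤ μ β)
    (hμ_reg : ∀ α < τ.ord, (μ α).IsRegular) (hμ_zero : κ ≤ μ 0)
    (hπ_card : (seqs μ τ.ord).card = 2 ^ κ)
    (hπ : Set.BijOn π {η | η ∈ seqs μ τ.ord} {h | h ∈ ZFSet.funs (cardSet κ) (cardSet κ)})
    (θ ι : Cardinal.{u}) (hθ : θ.IsRegular) (hθκ : θ < κ) (hθι : θ < ι) (hι : ι ^< κ = ι) :
    (Q κ τ μ π).IsForcingNotion ∧
    (Q κ τ μ π).LubComplete κ ∧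
    Manageable (Q κ τ μ π) θ ι κ ∧
    AddsDominatingFamily (Q κ τ μ π) κ τ μ := by
  have P : Params κ τ μ π := ⟨hκ, hκ_pow, hτ, hτκ,
    fun α hα => hμ_zero.trans (hμ_mono 0 α zero_le hα), hπ⟩
  exact ⟨isForcingNotion_Q P.mapsTo hκ, lubComplete_Q P,
    manageable_Q P hθ.aleph0_le hθκ hθι hι, addsDominatingFamily_Q P⟩
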